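/- **Setting.** Let $d\ge 1$, let $f:\mathbb R^d\to\mathbb R$ be locally Lipschitz with nonempty set of global minimizers $\mathcal X_*$ and optimal value $f^*$, fix $\bar x\in\mathcal X_*$ and $\delta>0$, and write $B_r(x)$ for open Euclidean balls. Let $g:\mathbb R^d\rightrightarrows\mathbb R^d$ be nonempty-valued and locally bounded. Let $\mu,C_b,\eta>0$ and assume * (A1) $f(x)-f^*\ge\mu\,\mathrm{dist}(x,\mathcal X_*)$ for all $x\in B_\delta(\bar x)$; * (A2) $|f(x)+\langle v,y-x\rangle-f^*|\le C_b\|y-x\|^{1+\eta}$ for all $x\in B_\delta(\bar x)$, $v\in g(x)$, $y\in\mathcal X_*\cap B_{2\delta}(\bar x)$. Let $L$ be an upper bound for $\|v\|$ over $v\in g(x)$, $x\in B_\delta(\bar x)$, and a Lipschitz constant of $f$ on $B_\delta(\bar x)$; put $\kappa=L/\mu$. **PolyakBundle$(x,\tau)$.** Set $y_0=x$. For $i=1,\dots,d$ choose any $v_{i-1}\in g(y_{i-1})$ and set $$y_i=y_0-A_i^\dagger\big[f(y_j)-f^*+\langle v_j,y_0-y_j\rangle\big]_{j=0}^{i-1},$$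 where $A_i$ is the $i\times d$ matrix with rows $v_0^\top,\dots,v_{i-1}^\top$ and $A_i^\dagger$ is its Moore–Penrose pseudoinverse. Return a point $y_s$ that minimizes $f$ among the $y_i$, $1\le i\le d$, with $\|y_i-y_0\|\le\tau(f(y_0)-f^*)$, or $\emptyset$ if there are none. A call makes $d$ evaluations of $g$. **SuperPolyak$(\mathcal A,x_0,\epsilon)$.** For $k=0,1,\dots$: let $\tilde x=\mathrm{PolyakBundle}(x_k,(3/2)^k)$. If $\tilde x\ne\emptyset$ and $f(\tilde x)-f^*<\frac12(f(x_k)-f^*)$, put $x_{k+1}=\tilde x$. Otherwise put $z_0=x_k$, iterate $z_{i+1}=\mathcal A(z_i)$ for $i=0,1,\dots$ until $f(z_{i+1})-f^*\le\frac12(f(x_k)-f^*)$, and put $x_{k+1}=z_{i+1}$. If $f(x_{k+1})-f^*\le\epsilon$, return $x_{k+1}$. **Theorem.** There is a constant $C_s>0$, depending only on $d,\mu,C_b,\eta,L$, with the following two properties. (i) Superlinear improvement: for all $\tau>3/\mu$ and all $x$ with $\|x-\bar x\|<\delta/4$ and $\mathrm{dist}(x,\mathcal X_*)\le\min\{(\frac{\mu}{2C_b})^{1/\eta},(\frac{\mu^{1-\eta}}{LC_s})^{1/\eta}\}$,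 every output $\tilde x$ of PolyakBundle$(x,\tau)$ is a point (not $\emptyset$), and $f(\tilde x)-f^*\le C_s(f(x)-f^*)^{1+\eta}$. (ii) Let $0<\varphi_2\le\varphi_1$, $\rho\in(0,1)$, and let $\mathcal A:B_{\varphi_1}(\bar x)\to\mathbb R^d$ satisfy * (A3) $\|\mathcal A(x)-\hat x\|\le\rho\,\mathrm{dist}(x,\mathcal X_*)$ for every $x\in B_{\varphi_1}(\bar x)\setminus\mathcal X_*$ with $\mathrm{dist}(x,\mathcal X_*)<\varphi_2$ and every nearest point $\hat x$ of $\mathcal X_*$ to $x$. Let $x_0\notin\mathcal X_*$ satisfy $$\|x_0-\bar x\|\le\Big\{\tfrac{2}{1-\rho}\Big(1+\max\big\{2\kappa\tfrac{1+\rho}{1-\rho},4L\big\}\Big)\Big\}^{-1}\min\{\tfrac\delta4,\varphi_1\},\qquad \mathrm{dist}(x_0,\mathcal X_*)\le\frac{\varphi_2}{1+\max\{2\kappa\frac{1+\rho}{1-\rho},\frac{4L}{3}\}}.$$ Put $\Delta=f(x_0)-f^*$ and let $K_1$ be the maximum of $0$ and $$\Big\lceil\max\Big\{\log_2\Big(\Delta\max\Big\{2(2C_s)^{1/\eta},\tfrac{(2C_b)^{1/\eta}}{\mu^{1+1/\eta}},(\kappa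 C_s)^{1/\eta}\Big\}\Big),\ \log_{3/2}\tfrac3\mu\Big\}\Big\rceil .$$ Then for every $\epsilon>0$ and whatever choices it makes, SuperPolyak$(\mathcal A,x_0,\epsilon)$ is well defined (it evaluates $\mathcal A$ only inside $B_{\varphi_1}(\bar x)$) and terminates with a point whose function gap is at most $\epsilon$, after at most $$\Big\lceil\tfrac{1}{1-\rho}\log(2\kappa)\Big\rceil K_1\ \text{ evaluations of }\mathcal A\qquad\text{and}\qquad d\max\{1,K_1+N_\epsilon\}\ \text{ evaluations of }g,$$ where $N_\epsilon=\big\lceil\frac{\log\log_2(1/\min\{\epsilon,1/2\})}{\log(1+\eta)}\big\rceil$, so that $N_\epsilon=\big\lceil\frac{\log\log_2(1/\epsilon)}{\log(1+\eta)}\big\rceil$ for $\epsilon\le\frac12$. Moreover the convergence is superlinear of order $1+\eta$: at every executed outer iteration $k\ge K_1$ the bundle step is accepted and $f(x_{k+1})-f^*\le C_s(f(x_k)-f^*)^{1+\eta}$. -/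

import Mathlib

open scoped Matrix

noncomputable section

namespace SuperPolyak

/-! ### The Moore-Penrose pseudoinverse of a real matrix -/

/-- The four Penrose equations: `B` is the Moore-Penrose pseudoinverse of `A`. -/
structure IsMoorePenrose {m n : ℕ} (A : Matrix (Fin m) (Fin n) ℝ)
    (B : Matrix (Fin n) (Fin m) ℝ) : Prop where
  mul_mul_left : A * B * A = A
  mul_mul_right : B * A * B = B
  symm_left : (A * B)ᵀ = A * B
  symm_right : (B * A)ᵀ = B * A

theorem IsMoorePenrose.unique {m n : ℕ} {A : Matrix (Fin m) (Fin n) ℝ}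
    {B C : Matrix (Fin n) (Fin m) ℝ} (hB : IsMoorePenrose A B) (hC : IsMoorePenrose A C) :
    B = C := by
  have h1 : A * B = A * C := by
    calc A * B = (A * B)ᵀ := hB.symm_left.symm
      _ = ((A * C) * (A * B))ᵀ := by
          rw [← Matrix.mul_assoc (A * C) A B, hC.mul_mul_left]
      _ = (A * B)ᵀ * (A * C)ᵀ := Matrix.transpose_mul _ _
      _ = (A * B) * (A * C) := by rw [hB.symm_left, hC.symm_left]
      _ = A * C := by rw [← Matrix.mul_assoc, hB.mul_mul_left]
  have h2 : B * A = C * A := by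
    calc B * A = (B * A)ᵀ := hB.symm_right.symm
      _ = ((B * A) * (C * A))ᵀ := by
          rw [Matrix.mul_assoc B A (C * A), ← Matrix.mul_assoc A C A, hC.mul_mul_left]
      _ = (C * A)ᵀ * (B * A)ᵀ := Matrix.transpose_mul _ _
      _ = (C * A) * (B * A) := by rw [hB.symm_right, hC.symm_right]
      _ = C * A := by rw [Matrix.mul_assoc C A (B * A), ← Matrix.mul_assoc A B A, hB.mul_mul_left]
  calc B = B * A * B := hB.mul_mul_right.symm
    _ = C * A * B := by rw [h2]
    _ = C * (A * C) := by rw [Matrix.mul_assoc, h1]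
    _ = C := by rw [← Matrix.mul_assoc, hC.mul_mul_right]

theorem exists_isMoorePenrose {m n : ℕ} (A : Matrix (Fin m) (Fin n) ℝ) :
    ∃ B, IsMoorePenrose A B := by
  have hM : (Aᵀ * A).IsHermitian := by
    simpa [Matrix.conjTranspose_eq_transpose_of_trivial] using
      Matrix.isHermitian_conjTranspose_mul_self A
  obtain ⟨P, hP1, hP2, hPs, hPc⟩ : ∃ P : Matrix (Fin n) (Fin n) ℝ,
      (Aᵀ * A) * P * (Aᵀ * A) = Aᵀ * A ∧ P * (Aᵀ * A) * P = P ∧ Pᵀ = P ∧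
        P * (Aᵀ * A) = (Aᵀ * A) * P := by
    set U : Matrix (Fin n) (Fin n) ℝ := (hM.eigenvectorUnitary : Matrix (Fin n) (Fin n) ℝ) with hU
    have hUU : Uᵀ * U = 1 := by
      have := Unitary.coe_star_mul_self hM.eigenvectorUnitary
      rwa [Matrix.star_eq_conjTranspose, Matrix.conjTranspose_eq_transpose_of_trivial] at this
    have hsp : Aᵀ * A = U * Matrix.diagonal hM.eigenvalues * Uᵀ := by
      have := hM.spectral_theorem
      rw [Unitary.conjStarAlgAut_apply, Matrix.star_eq_conjTranspose,
        Matrix.conjTranspose_eq_transpose_of_trivial] at this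
      simpa [Function.comp_def] using this
    have key : ∀ D E : Matrix (Fin n) (Fin n) ℝ,
        (U * D * Uᵀ) * (U * E * Uᵀ) = U * (D * E) * Uᵀ := by
      intro D E
      calc (U * D * Uᵀ) * (U * E * Uᵀ) = U * D * (Uᵀ * U) * E * Uᵀ := by
            simp only [Matrix.mul_assoc]
        _ = U * (D * E) * Uᵀ := by rw [hUU]; simp only [Matrix.mul_assoc, Matrix.one_mul]
    generalize hM.eigenvalues = D at hsp
    clear_value U
    rw [hsp]
    refine ⟨U * Matrix.diagonal (fun i => (D i)⁻¹) * Uᵀ, ?_, ?_, ?_, ?_⟩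
    · rw [key, key, Matrix.diagonal_mul_diagonal, Matrix.diagonal_mul_diagonal]
      congr 3; funext i; exact mul_inv_mul_cancel _
    · rw [key, key, Matrix.diagonal_mul_diagonal, Matrix.diagonal_mul_diagonal]
      congr 3; funext i; by_cases h : D i = 0 <;> simp [h]
    · simp [Matrix.transpose_mul, Matrix.mul_assoc]
    · rw [key, key, Matrix.diagonal_mul_diagonal, Matrix.diagonal_mul_diagonal]
      congr 3; funext i; exact mul_comm _ _
  have hA : A * P * (Aᵀ * A) = A := by
    have h0 : Aᴴ * A * (P * (Aᵀ * A) - 1) = 0 := by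
      rw [Matrix.conjTranspose_eq_transpose_of_trivial, Matrix.mul_sub, ← Matrix.mul_assoc, hP1,
        Matrix.mul_one, sub_self]
    have h1 := (Matrix.conjTranspose_mul_self_mul_eq_zero A _).1 h0
    rw [Matrix.mul_sub, Matrix.mul_one, sub_eq_zero] at h1
    rw [Matrix.mul_assoc]; exact h1
  refine ⟨P * Aᵀ, ?_, ?_, ?_, ?_⟩
  · simpa only [Matrix.mul_assoc] using hA
  · calc P * Aᵀ * A * (P * Aᵀ) = (P * (Aᵀ * A) * P) * Aᵀ := by simp only [Matrix.mul_assoc]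
      _ = P * Aᵀ := by rw [hP2]
  · simp [Matrix.transpose_mul, hPs, Matrix.mul_assoc]
  · calc (P * Aᵀ * A)ᵀ = (Aᵀ * A) * P := by
          simp [Matrix.transpose_mul, hPs, Matrix.mul_assoc]
      _ = P * Aᵀ * A := by rw [← hPc, Matrix.mul_assoc]

/-- The Moore-Penrose pseudoinverse of a real matrix. -/
def pinv {m n : ℕ} (A : Matrix (Fin m) (Fin n) ℝ) : Matrix (Fin n) (Fin m) ℝ :=
  Classical.choose (exists_isMoorePenrose A)

theorem pinv_spec {m n : ℕ} (A : Matrix (Fin m) (Fin n) ℝ) : IsMoorePenrose A (pinv A) :=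
  Classical.choose_spec (exists_isMoorePenrose A)

/-! ### The optimization problem and the three assumptions -/

/-- The set of global minimizers of `f`. -/
def argminSet {d : ℕ} (f : EuclideanSpace ℝ (Fin d) → ℝ) : Set (EuclideanSpace ℝ (Fin d)) :=
  {x | ∀ y, f x ≤ f y}

/-- The function gap `f x - f*`, where `f*` is the optimal value. It is only used for functions
that attain their minimum. -/
def gap {d : ℕ} (f : EuclideanSpace ℝ (Fin d) → ℝ) (x : EuclideanSpace ℝ (Fin d)) : ℝ :=
  f x - ⨅ y, f y

/-- The set of nearest points of `S` to `x`. -/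
def projSet {d : ℕ} (S : Set (EuclideanSpace ℝ (Fin d))) (x : EuclideanSpace ℝ (Fin d)) :
    Set (EuclideanSpace ℝ (Fin d)) :=
  {y | y ∈ S ∧ ∀ z ∈ S, ‖y - x‖ ≤ ‖z - x‖}

/-- Sharp growth with constant `μ` on the open ball of radius `δ` around `xbar`. -/
def Sharp {d : ℕ} (f : EuclideanSpace ℝ (Fin d) → ℝ) (xbar : EuclideanSpace ℝ (Fin d))
    (δ μ : ℝ) : Prop :=
  ∀ x ∈ Metric.ball xbar δ, μ * Metric.infDist x (argminSet f) ≤ gap f x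

/-- The set-valued mapping `g` is nonempty-valued and locally bounded. -/
def IsGeneralizedGradientMap {d : ℕ}
    (g : EuclideanSpace ℝ (Fin d) → Set (EuclideanSpace ℝ (Fin d))) : Prop :=
  (∀ x, (g x).Nonempty) ∧ ∀ S, Bornology.IsBounded S → Bornology.IsBounded (⋃ x ∈ S, g x)

/-- The `(b)`-regularity estimate with constant `Cb` and exponent `1 + η`. -/
def BRegular {d : ℕ} (f : EuclideanSpace ℝ (Fin d) → ℝ)
    (g : EuclideanSpace ℝ (Fin d) → Set (EuclideanSpace ℝ (Fin d)))
    (xbar : EuclideanSpace ℝ (Fin d)) (δ Cb η : ℝ) : Prop :=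
  ∀ x ∈ Metric.ball xbar δ, ∀ v ∈ g x, ∀ y ∈ argminSet f ∩ Metric.ball xbar (2 * δ),
    |gap f x + inner ℝ v (y - x)| ≤ Cb * ‖y - x‖ ^ (1 + η)

/-- `L` bounds all elements of `g` over the ball and is a Lipschitz constant of `f` there. -/
def IsLipBound {d : ℕ} (f : EuclideanSpace ℝ (Fin d) → ℝ)
    (g : EuclideanSpace ℝ (Fin d) → Set (EuclideanSpace ℝ (Fin d)))
    (xbar : EuclideanSpace ℝ (Fin d)) (δ L : ℝ) : Prop :=
  (∀ x ∈ Metric.ball xbar δ, ∀ v ∈ g x, ‖v‖ ≤ L) ∧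
    ∀ x ∈ Metric.ball xbar δ, ∀ y ∈ Metric.ball xbar δ, |f x - f y| ≤ L * ‖x - y‖

/-- `A`, defined on the open ball of radius `φ₁` around `xbar`, is an algorithmic mapping with
contraction factor `ρ` and radii `φ₁`, `φ₂`. -/
def IsAlgorithmicMapping {d : ℕ} (f : EuclideanSpace ℝ (Fin d) → ℝ)
    (xbar : EuclideanSpace ℝ (Fin d)) (φ₁ φ₂ ρ : ℝ)
    (A : Metric.ball xbar φ₁ → EuclideanSpace ℝ (Fin d)) : Prop :=
  ∀ x : Metric.ball xbar φ₁, (x : EuclideanSpace ℝ (Fin d)) ∉ argminSet f →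
    Metric.infDist (x : EuclideanSpace ℝ (Fin d)) (argminSet f) < φ₂ →
    ∀ xhat ∈ projSet (argminSet f) (x : EuclideanSpace ℝ (Fin d)),
      ‖A x - xhat‖ ≤ ρ * Metric.infDist (x : EuclideanSpace ℝ (Fin d)) (argminSet f)

/-! ### The bundle procedure -/

/-- The `i × d` matrix with rows `v 0, …, v (i - 1)`. -/
def bundleMatrix {d : ℕ} (v : ℕ → EuclideanSpace ℝ (Fin d)) (i : ℕ) :
    Matrix (Fin i) (Fin d) ℝ :=
  Matrix.of fun j c => v j c

/-- The vector with entries `f (y j) - f* + ⟪v j, y 0 - y j⟫` for `j = 0, …, i - 1`. -/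
def bundleVector {d : ℕ} (f : EuclideanSpace ℝ (Fin d) → ℝ)
    (y v : ℕ → EuclideanSpace ℝ (Fin d)) (i : ℕ) : Fin i → ℝ :=
  fun j => gap f (y j) + inner ℝ (v j) (y 0 - y j)

/-- `y 0, …, y d` and `v 0, …, v (d - 1)` are the points and generalized gradients of one call of
the bundle procedure from `x`. The `v i` are arbitrary elements of `g (y i)`; the call makes one
evaluation of `g` for each of `v 0, …, v (d - 1)`, that is `d` evaluations. Values at larger
indices are irrelevant. -/
def IsBundleRun {d : ℕ} (f : EuclideanSpace ℝ (Fin d) → ℝ)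
    (g : EuclideanSpace ℝ (Fin d) → Set (EuclideanSpace ℝ (Fin d)))
    (x : EuclideanSpace ℝ (Fin d)) (y v : ℕ → EuclideanSpace ℝ (Fin d)) : Prop :=
  y 0 = x ∧ (∀ i < d, v i ∈ g (y i)) ∧
    ∀ i ∈ Finset.Icc 1 d,
      y i = y 0 - WithLp.toLp 2 (pinv (bundleMatrix v i) *ᵥ bundleVector f y v i)

/-- The indices `i = 1, …, d` with `‖y i - y 0‖ ≤ τ (f (y 0) - f*)`. -/
def admissible {d : ℕ} (f : EuclideanSpace ℝ (Fin d) → ℝ) (τ : ℝ)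
    (y : ℕ → EuclideanSpace ℝ (Fin d)) : Set ℕ :=
  {i | i ∈ Finset.Icc 1 d ∧ ‖y i - y 0‖ ≤ τ * gap f (y 0)}

/-- `PolyakBundle f g x τ r`: the bundle procedure called with `x` and `τ` can return `r`. The
output is `none` if no index is admissible, and otherwise some `y s` with `s` an admissible index
that minimizes `f (y s)`. -/
inductive PolyakBundle {d : ℕ} (f : EuclideanSpace ℝ (Fin d) → ℝ)
    (g : EuclideanSpace ℝ (Fin d) → Set (EuclideanSpace ℝ (Fin d)))
    (x : EuclideanSpace ℝ (Fin d)) (τ : ℝ) : Option (EuclideanSpace ℝ (Fin d)) → Prop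
  | empty (y v : ℕ → EuclideanSpace ℝ (Fin d)) (hrun : IsBundleRun f g x y v)
      (hnone : admissible f τ y = ∅) : PolyakBundle f g x τ none
  | point (y v : ℕ → EuclideanSpace ℝ (Fin d)) (hrun : IsBundleRun f g x y v) (s : ℕ)
      (hs : s ∈ admissible f τ y) (hmin : ∀ i ∈ admissible f τ y, f (y s) ≤ f (y i)) :
      PolyakBundle f g x τ (some (y s))

/-- `Cs` is a constant of superlinear improvement for the bundle procedure. -/
def SuperlinearImprovement {d : ℕ} (f : EuclideanSpace ℝ (Fin d) → ℝ)
    (g : EuclideanSpace ℝ (Fin d) → Set (EuclideanSpace ℝ (Fin d)))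
    (xbar : EuclideanSpace ℝ (Fin d)) (δ μ Cb η L Cs : ℝ) : Prop :=
  ∀ τ : ℝ, 3 / μ < τ → ∀ x : EuclideanSpace ℝ (Fin d), ‖x - xbar‖ < δ / 4 →
    Metric.infDist x (argminSet f) ≤
      min ((μ / (2 * Cb)) ^ (1 / η)) ((μ ^ (1 - η) / (L * Cs)) ^ (1 / η)) →
    ∀ r, PolyakBundle f g x τ r → ∃ xt, r = some xt ∧ gap f xt ≤ Cs * gap f x ^ (1 + η)

/-! ### The coupled algorithm as a transition system that counts evaluations -/

/-- Control states: at the top of outer iteration `k` with iterate `x`; inside the fallback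
algorithm of outer iteration `k` (started at the iterate `x`, now at `z`); returned `x`. -/
inductive State (E : Type)
  | top (k : ℕ) (x : E)
  | fallback (k : ℕ) (x z : E)
  | halt (x : E)

/-- A control state together with the numbers of evaluations of the algorithmic mapping and of
`g` made so far. -/
structure Config (E : Type) where
  state : State E
  aEvals : ℕ
  gEvals : ℕ

open Classical in
/-- The state after outer iteration `k` has produced the next iterate `x'`: the algorithm returns
`x'` if its function gap is at most `ε` and goes on to outer iteration `k + 1` otherwise. -/
def afterIterate {d : ℕ} (f : EuclideanSpace ℝ (Fin d) → ℝ) (ε : ℝ) (k : ℕ)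
    (x' : EuclideanSpace ℝ (Fin d)) : State (EuclideanSpace ℝ (Fin d)) :=
  if gap f x' ≤ ε then State.halt x' else State.top (k + 1) x'

/-- The transitions. A bundle call costs `d` evaluations of `g`; a fallback iteration `z ↦ A z`
costs one evaluation of `A` and is only possible when `z` lies in the domain of `A`. -/
inductive Step {d : ℕ} (f : EuclideanSpace ℝ (Fin d) → ℝ)
    (g : EuclideanSpace ℝ (Fin d) → Set (EuclideanSpace ℝ (Fin d)))
    (xbar : EuclideanSpace ℝ (Fin d)) (φ₁ : ℝ)
    (A : Metric.ball xbar φ₁ → EuclideanSpace ℝ (Fin d)) (ε : ℝ) :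
    Config (EuclideanSpace ℝ (Fin d)) → Config (EuclideanSpace ℝ (Fin d)) → Prop
  | accept (k a n : ℕ) (x xt : EuclideanSpace ℝ (Fin d))
      (hb : PolyakBundle f g x ((3 / 2 : ℝ) ^ k) (some xt)) (hlt : gap f xt < 1 / 2 * gap f x) :
      Step f g xbar φ₁ A ε ⟨State.top k x, a, n⟩ ⟨afterIterate f ε k xt, a, n + d⟩
  | reject (k a n : ℕ) (x : EuclideanSpace ℝ (Fin d)) (r : Option (EuclideanSpace ℝ (Fin d)))
      (hb : PolyakBundle f g x ((3 / 2 : ℝ) ^ k) r)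
      (hnot : ∀ xt, r = some xt → ¬ gap f xt < 1 / 2 * gap f x) :
      Step f g xbar φ₁ A ε ⟨State.top k x, a, n⟩ ⟨State.fallback k x x, a, n + d⟩
  | fallbackContinue (k a n : ℕ) (x z : EuclideanSpace ℝ (Fin d)) (hz : z ∈ Metric.ball xbar φ₁)
      (hgt : ¬ gap f (A ⟨z, hz⟩) ≤ 1 / 2 * gap f x) :
      Step f g xbar φ₁ A ε ⟨State.fallback k x z, a, n⟩
        ⟨State.fallback k x (A ⟨z, hz⟩), a + 1, n⟩
  | fallbackReturn (k a n : ℕ) (x z : EuclideanSpace ℝ (Fin d)) (hz : z ∈ Metric.ball xbar φ₁)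
      (hle : gap f (A ⟨z, hz⟩) ≤ 1 / 2 * gap f x) :
      Step f g xbar φ₁ A ε ⟨State.fallback k x z, a, n⟩
        ⟨afterIterate f ε k (A ⟨z, hz⟩), a + 1, n⟩

/-- The configuration has returned a point. -/
def Config.Halted {E : Type} (c : Config E) : Prop := ∃ x, c.state = State.halt x

/-- `c` can be reached by a run of the algorithm started at `x₀`. -/
def Reachable {d : ℕ} (f : EuclideanSpace ℝ (Fin d) → ℝ)
    (g : EuclideanSpace ℝ (Fin d) → Set (EuclideanSpace ℝ (Fin d)))
    (xbar : EuclideanSpace ℝ (Fin d)) (φ₁ : ℝ)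
    (A : Metric.ball xbar φ₁ → EuclideanSpace ℝ (Fin d)) (ε : ℝ)
    (x₀ : EuclideanSpace ℝ (Fin d)) (c : Config (EuclideanSpace ℝ (Fin d))) : Prop :=
  Relation.ReflTransGen (Step f g xbar φ₁ A ε) ⟨State.top 0 x₀, 0, 0⟩ c

/-- `c` is the sequence of configurations of a run started at `x₀`; after the run has halted the
sequence is constant. -/
def IsExecution {d : ℕ} (f : EuclideanSpace ℝ (Fin d) → ℝ)
    (g : EuclideanSpace ℝ (Fin d) → Set (EuclideanSpace ℝ (Fin d)))
    (xbar : EuclideanSpace ℝ (Fin d)) (φ₁ : ℝ)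
    (A : Metric.ball xbar φ₁ → EuclideanSpace ℝ (Fin d)) (ε : ℝ)
    (x₀ : EuclideanSpace ℝ (Fin d)) (c : ℕ → Config (EuclideanSpace ℝ (Fin d))) : Prop :=
  c 0 = ⟨State.top 0 x₀, 0, 0⟩ ∧
    ∀ n, Step f g xbar φ₁ A ε (c n) (c (n + 1)) ∨ ((c n).Halted ∧ c (n + 1) = c n)

/-- The algorithm successfully terminates from `x₀` with at most `NA` evaluations of `A` and at
most `Ng` evaluations of `g`, whatever choices it makes: it never gets stuck, and every run
returns, within the two budgets, a point with function gap at most `ε`. -/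
def TerminatesWithin {d : ℕ} (f : EuclideanSpace ℝ (Fin d) → ℝ)
    (g : EuclideanSpace ℝ (Fin d) → Set (EuclideanSpace ℝ (Fin d)))
    (xbar : EuclideanSpace ℝ (Fin d)) (φ₁ : ℝ)
    (A : Metric.ball xbar φ₁ → EuclideanSpace ℝ (Fin d)) (ε : ℝ)
    (x₀ : EuclideanSpace ℝ (Fin d)) (NA Ng : ℕ) : Prop :=
  (∀ c, Reachable f g xbar φ₁ A ε x₀ c → ¬ c.Halted → ∃ c', Step f g xbar φ₁ A ε c c') ∧
    ∀ c, IsExecution f g xbar φ₁ A ε x₀ c →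
      ∃ n x, (c n).state = State.halt x ∧ gap f x ≤ ε ∧ (c n).aEvals ≤ NA ∧ (c n).gEvals ≤ Ng

/-- From outer iteration `K` on, every step of every run is a successful bundle step and improves
the function gap superlinearly with order `1 + η` and constant `Cs`. -/
def SuperlinearFrom {d : ℕ} (f : EuclideanSpace ℝ (Fin d) → ℝ)
    (g : EuclideanSpace ℝ (Fin d) → Set (EuclideanSpace ℝ (Fin d)))
    (xbar : EuclideanSpace ℝ (Fin d)) (φ₁ : ℝ)
    (A : Metric.ball xbar φ₁ → EuclideanSpace ℝ (Fin d)) (ε : ℝ)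
    (x₀ : EuclideanSpace ℝ (Fin d)) (η Cs : ℝ) (K : ℕ) : Prop :=
  ∀ (k a n : ℕ) (x : EuclideanSpace ℝ (Fin d)) (c' : Config (EuclideanSpace ℝ (Fin d))),
    K ≤ k → Reachable f g xbar φ₁ A ε x₀ ⟨State.top k x, a, n⟩ →
    Step f g xbar φ₁ A ε ⟨State.top k x, a, n⟩ c' →
    ∃ x', c' = ⟨afterIterate f ε k x', a, n + d⟩ ∧ gap f x' ≤ Cs * gap f x ^ (1 + η)

/-- The number `K₁` of outer iterations before superlinear convergence, where `Δ` is the initial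
function gap and `κ = L / μ`. -/
def burnIn (μ Cb η L Cs Δ : ℝ) : ℕ :=
  ⌈max
    (Real.logb 2 (Δ * max (2 * (2 * Cs) ^ (1 / η))
      (max ((2 * Cb) ^ (1 / η) / μ ^ (1 + 1 / η)) ((L / μ * Cs) ^ (1 / η)))))
    (Real.logb (3 / 2) (3 / μ))⌉₊

end SuperPolyak

end

/-!
The bundle step. Let `D` be the distance from `x` to the minimizers. Sharp growth and the
`(b)`-regularity estimate say that at a point at distance at most `10 D` from a minimizer `q`, the
linear model `gap f (y j) + ⟪v j, · - y j⟫` vanishes at `q` up to an error of order `D ^ (1 + η)`.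
As long as `v 0, …, v (i - 1)` are quantitatively independent, `y i` is a common zero of the first
`i` models, so `y i - q` is orthogonal to these gradients up to order `D ^ (1 + η)`, for *every*
nearby minimizer `q`. Taking `q` nearest to `x` shows that `y i` stays within `3 D` of `x`
(`IsLocalBundleRun.norm_sub_le`). Taking `q` nearest to `y i` shows the dichotomy that carries the
proof (`IsLocalBundleRun.isSeparated_succ`): either the gap at `y i` is already of order
`D ^ (1 + η)`, or `v i` has inner product of order `μ ‖y i - q‖` with a vector almost orthogonal to
its predecessors, so that `v i` has distance at least `μ / 4` from their span. After `d` such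
gradients the span is the whole space and `y d` itself is within order `D ^ (1 + η)` of a minimizer
(`IsLocalBundleRun.exists_small_gap`). The constants depend only on `d, μ, Cb, η, L` because
`frameConst` bounds the inverse of a separated system in terms of `L` and `μ / 4`.

The coupled algorithm. The function gap is at least halved in each outer iteration, while an
accepted bundle step has length at most `(3/2)^k` times the gap and a fallback moves by at most
`(1 + ρ)/(1 - ρ)` times the distance to the minimizers; both lengths are summable, so that the
iterates stay in the region where the assumptions hold. From outer iteration `burnIn` on, the
iterates satisfy the hypotheses of the bundle step, and `gap ↦ Cs * gap ^ (1 + η)` is iterated. All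
of this is recorded in one `Invariant` of the transition system, which also bounds the two numbers
of evaluations. Every transition costs an evaluation, so the algorithm halts
(`IsCoupledRegime.terminatesWithin`).
-/

noncomputable section

namespace SuperPolyak

/-! ### Quantitatively independent vectors and the pseudoinverse -/

/-- The span of `v 0, …, v (i - 1)`. -/
def initialSpan {d : ℕ} (v : ℕ → EuclideanSpace ℝ (Fin d)) (i : ℕ) :
    Submodule ℝ (EuclideanSpace ℝ (Fin d)) :=
  Submodule.span ℝ (Set.range fun j : Fin i => v j)

theorem mem_initialSpan {d : ℕ} (v : ℕ → EuclideanSpace ℝ (Fin d)) {i j : ℕ} (h : j < i) :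
    v j ∈ initialSpan v i :=
  Submodule.subset_span ⟨⟨j, h⟩, rfl⟩

theorem initialSpan_zero {d : ℕ} (v : ℕ → EuclideanSpace ℝ (Fin d)) : initialSpan v 0 = ⊥ := by
  simp [initialSpan]

theorem initialSpan_succ {d : ℕ} (v : ℕ → EuclideanSpace ℝ (Fin d)) (i : ℕ) :
    initialSpan v (i + 1) = initialSpan v i ⊔ Submodule.span ℝ {v i} := by
  apply le_antisymm
  · refine Submodule.span_le.2 ?_
    rintro _ ⟨j, rfl⟩
    rcases Nat.lt_succ_iff_lt_or_eq.1 j.2 with h | h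
    · exact Submodule.mem_sup_left (mem_initialSpan v h)
    · refine Submodule.mem_sup_right ?_
      simp [h, Submodule.mem_span_singleton_self]
  · refine sup_le (Submodule.span_le.2 ?_) (Submodule.span_le.2 ?_)
    · rintro _ ⟨j, rfl⟩
      exact mem_initialSpan v (j.2.trans (Nat.lt_succ_self i))
    · simpa using mem_initialSpan v (Nat.lt_succ_self i)

/-- Each of `v 0, …, v (i - 1)` has distance at least `c` from the span of its predecessors. -/
def IsSeparated {d : ℕ} (c : ℝ) (v : ℕ → EuclideanSpace ℝ (Fin d)) (i : ℕ) : Prop :=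
  ∀ j < i, ∀ w ∈ initialSpan v j, c ≤ ‖v j - w‖

theorem IsSeparated.linearIndependent {d : ℕ} {c : ℝ} (hc : 0 < c)
    {v : ℕ → EuclideanSpace ℝ (Fin d)} {i : ℕ} (h : IsSeparated c v i) :
    LinearIndependent ℝ fun j : Fin i => v j := by
  induction i with
  | zero => exact linearIndependent_empty_type
  | succ i ih =>
    rw [linearIndependent_finSucc']
    refine ⟨ih fun j hj => h j (hj.trans (Nat.lt_succ_self i)), fun hmem => ?_⟩
    have := h i (Nat.lt_succ_self i) (v i) hmem
    simp at this
    linarith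

/-- The constants of `IsSeparated.norm_le`: how well the inner products with `i` vectors of norm at
most `L` that are separated by `c` control a vector in their span. -/
def frameConst (L c : ℝ) : ℕ → ℝ
  | 0 => 0
  | i + 1 => frameConst L c i + (1 + L * frameConst L c i) / c

theorem frameConst_nonneg {L c : ℝ} (hL : 0 ≤ L) (hc : 0 < c) (i : ℕ) : 0 ≤ frameConst L c i := by
  induction i with
  | zero => exact le_rfl
  | succ i ih => rw [frameConst]; positivity

theorem frameConst_mono {L c : ℝ} (hL : 0 ≤ L) (hc : 0 < c) : Monotone (frameConst L c) := by
  refine monotone_nat_of_le_succ fun i => ?_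
  have := frameConst_nonneg hL hc i
  rw [frameConst]
  have : 0 ≤ (1 + L * frameConst L c i) / c := by positivity
  linarith

/-- Inner products with separated vectors control the vectors in their span. In the induction, the
component of the last vector orthogonal to its predecessors is invisible to these predecessors. -/
theorem IsSeparated.norm_le {d : ℕ} {L c t : ℝ} (hL : 0 ≤ L) (hc : 0 < c)
    {v : ℕ → EuclideanSpace ℝ (Fin d)} {i : ℕ} (h : IsSeparated c v i)
    (hv : ∀ j < i, ‖v j‖ ≤ L) {w : EuclideanSpace ℝ (Fin d)} (hw : w ∈ initialSpan v i)
    (hin : ∀ j < i, |inner ℝ (v j) w| ≤ t) : ‖w‖ ≤ frameConst L c i * t := by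
  induction i generalizing w with
  | zero =>
    rw [initialSpan_zero, Submodule.mem_bot] at hw
    simp [hw, frameConst]
  | succ i ih =>
    rw [initialSpan_succ, Submodule.mem_sup] at hw
    obtain ⟨a', ha', s, hs, rfl⟩ := hw
    obtain ⟨r, rfl⟩ := Submodule.mem_span_singleton.1 hs
    -- Split `v i = p + u` with `p` in the span of the earlier vectors and `u` orthogonal to it.
    set p := (initialSpan v i).starProjection (v i) with hp
    set u := v i - p with hu
    have hpm : p ∈ initialSpan v i := Submodule.starProjection_apply_mem _ _
    have horth : ∀ q ∈ initialSpan v i, inner ℝ q u = 0 := fun q hq =>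
      (Submodule.mem_orthogonal _ _).1 (Submodule.sub_starProjection_mem_orthogonal (v i)) q hq
    set a := a' + r • p with ha
    have ham : a ∈ initialSpan v i := add_mem ha' (Submodule.smul_mem _ _ hpm)
    have hdec : a' + r • v i = a + r • u := by
      rw [ha, hu, smul_sub]; abel
    rw [hdec] at hin ⊢
    have hcu : c ≤ ‖u‖ := h i (Nat.lt_succ_self i) p hpm
    have hla : ‖a‖ ≤ frameConst L c i * t := by
      refine ih (fun j hj => h j (hj.trans (Nat.lt_succ_self i)))
        (fun j hj => hv j (hj.trans (Nat.lt_succ_self i))) ham fun j hj => ?_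
      have := hin j (hj.trans (Nat.lt_succ_self i))
      rwa [inner_add_right, inner_smul_right, horth _ (mem_initialSpan v hj), mul_zero,
        add_zero] at this
    have hvu : inner ℝ (v i) u = ‖u‖ ^ 2 := by
      have : v i = p + u := by rw [hu]; abel
      rw [this, inner_add_left, horth p hpm, zero_add, real_inner_self_eq_norm_sq]
    have h1 : |r| * ‖u‖ ^ 2 ≤ t + L * (frameConst L c i * t) := by
      have e1 := hin i (Nat.lt_succ_self i)
      rw [inner_add_right, inner_smul_right, hvu] at e1
      have e2 : |inner ℝ (v i) a| ≤ L * (frameConst L c i * t) :=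
        (abs_real_inner_le_norm _ _).trans
          (mul_le_mul (hv i (Nat.lt_succ_self i)) hla (norm_nonneg _) hL)
      have e3 : |r| * ‖u‖ ^ 2 = |r * ‖u‖ ^ 2| := by rw [abs_mul, abs_of_nonneg (sq_nonneg ‖u‖)]
      rw [e3]
      calc |r * ‖u‖ ^ 2| = |(inner ℝ (v i) a + r * ‖u‖ ^ 2) - inner ℝ (v i) a| := by congr 1; ring
        _ ≤ |inner ℝ (v i) a + r * ‖u‖ ^ 2| + |inner ℝ (v i) a| := abs_sub _ _
        _ ≤ _ := add_le_add e1 e2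
    have h2 : ‖r • u‖ ≤ (1 + L * frameConst L c i) / c * t := by
      rw [norm_smul, Real.norm_eq_abs, div_mul_eq_mul_div, le_div_iff₀ hc]
      calc |r| * ‖u‖ * c ≤ |r| * ‖u‖ * ‖u‖ := by gcongr
        _ = |r| * ‖u‖ ^ 2 := by ring
        _ ≤ t + L * (frameConst L c i * t) := h1
        _ = _ := by ring
    calc ‖a + r • u‖ ≤ ‖a‖ + ‖r • u‖ := norm_add_le _ _
      _ ≤ frameConst L c i * t + (1 + L * frameConst L c i) / c * t := add_le_add hla h2
      _ = _ := by rw [frameConst]; ring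

theorem IsSeparated.norm_starProjection_le {d : ℕ} {L c t : ℝ} (hL : 0 ≤ L) (hc : 0 < c)
    {v : ℕ → EuclideanSpace ℝ (Fin d)} {i : ℕ} (h : IsSeparated c v i)
    (hv : ∀ j < i, ‖v j‖ ≤ L) {z : EuclideanSpace ℝ (Fin d)}
    (hin : ∀ j < i, |inner ℝ (v j) z| ≤ t) :
    ‖(initialSpan v i).starProjection z‖ ≤ frameConst L c i * t := by
  refine h.norm_le hL hc hv (Submodule.starProjection_apply_mem _ _) fun j hj => ?_
  have e : inner ℝ (v j) ((initialSpan v i).starProjection z) = inner ℝ (v j) z := by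
    rw [← Submodule.inner_starProjection_left_eq_right,
      Submodule.starProjection_eq_self_iff.2 (mem_initialSpan v hj)]
  rw [e]
  exact hin j hj

/-- `d` separated vectors span the whole space. -/
theorem IsSeparated.initialSpan_eq_top {d : ℕ} {c : ℝ} (hc : 0 < c)
    {v : ℕ → EuclideanSpace ℝ (Fin d)} (h : IsSeparated c v d) : initialSpan v d = ⊤ :=
  (h.linearIndependent hc).span_eq_top_of_card_eq_finrank' (by simp)

theorem inner_eq_bundleMatrix_mulVec {d : ℕ} (v : ℕ → EuclideanSpace ℝ (Fin d)) (i : ℕ)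
    (w : Fin d → ℝ) (j : Fin i) :
    inner ℝ (v j) (WithLp.toLp 2 w) = (bundleMatrix v i *ᵥ w) j := by
  simp [bundleMatrix, Matrix.mulVec, dotProduct, PiLp.inner_apply, mul_comm]

/-- For independent rows, the pseudoinverse solves the linear system exactly. -/
theorem bundleMatrix_mulVec_pinv {d : ℕ} {v : ℕ → EuclideanSpace ℝ (Fin d)} {i : ℕ}
    (h : LinearIndependent ℝ fun j : Fin i => v j) (b : Fin i → ℝ) :
    bundleMatrix v i *ᵥ (pinv (bundleMatrix v i) *ᵥ b) = b := by
  have hrow : LinearIndependent ℝ (bundleMatrix v i).row :=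
    h.map' (WithLp.linearEquiv 2 ℝ (Fin d → ℝ)).toLinearMap (LinearEquiv.ker _)
  have hinj := Matrix.vecMul_injective_iff.2 hrow
  have h1 : bundleMatrix v i * pinv (bundleMatrix v i) = 1 := by
    funext j
    apply hinj
    have : (bundleMatrix v i * pinv (bundleMatrix v i)) j ᵥ* bundleMatrix v i =
        (1 : Matrix (Fin i) (Fin i) ℝ) j ᵥ* bundleMatrix v i := by
      rw [← Matrix.mul_apply_eq_vecMul, ← Matrix.mul_apply_eq_vecMul,
        (pinv_spec (bundleMatrix v i)).mul_mul_left, Matrix.one_mul]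
    exact this
  rw [Matrix.mulVec_mulVec, h1, Matrix.one_mulVec]

/-- The range of the pseudoinverse is contained in the span of the rows. -/
theorem toLp_pinv_mulVec_mem {d : ℕ} (v : ℕ → EuclideanSpace ℝ (Fin d)) (i : ℕ)
    (b : Fin i → ℝ) :
    WithLp.toLp 2 (pinv (bundleMatrix v i) *ᵥ b) ∈ initialSpan v i := by
  set A := bundleMatrix v i with hA
  have hs := pinv_spec A
  have h1 : pinv A *ᵥ b = ((pinv A)ᵀ *ᵥ (pinv A *ᵥ b)) ᵥ* A := by
    calc pinv A *ᵥ b = (pinv A * A) *ᵥ (pinv A *ᵥ b) := by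
          rw [Matrix.mulVec_mulVec, hs.mul_mul_right]
      _ = (pinv A * A)ᵀ *ᵥ (pinv A *ᵥ b) := by rw [hs.symm_right]
      _ = _ := by rw [Matrix.transpose_mul, ← Matrix.mulVec_mulVec, Matrix.mulVec_transpose A]
  rw [h1]
  generalize (pinv A)ᵀ *ᵥ (pinv A *ᵥ b) = u
  have h2 : WithLp.toLp 2 (u ᵥ* A) = ∑ j : Fin i, u j • v j := by
    ext k
    simp [Matrix.vecMul, dotProduct, hA, bundleMatrix]
  rw [h2]
  exact Submodule.sum_mem _ fun j _ => Submodule.smul_mem _ _ (mem_initialSpan v j.2)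

/-! ### The function gap and nearest minimizers -/

theorem gap_eq_sub {d : ℕ} {f : EuclideanSpace ℝ (Fin d) → ℝ} {p : EuclideanSpace ℝ (Fin d)}
    (hp : p ∈ argminSet f) (x : EuclideanSpace ℝ (Fin d)) : gap f x = f x - f p := by
  have : ⨅ y, f y = f p :=
    le_antisymm (ciInf_le ⟨f p, by rintro _ ⟨y, rfl⟩; exact hp y⟩ p) (le_ciInf hp)
  rw [gap, this]

theorem gap_nonneg {d : ℕ} {f : EuclideanSpace ℝ (Fin d) → ℝ} (hne : (argminSet f).Nonempty)
    (x : EuclideanSpace ℝ (Fin d)) : 0 ≤ gap f x := by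
  obtain ⟨p, hp⟩ := hne
  rw [gap_eq_sub hp]
  exact sub_nonneg.2 (hp x)

theorem gap_pos_iff {d : ℕ} {f : EuclideanSpace ℝ (Fin d) → ℝ} (hne : (argminSet f).Nonempty)
    (x : EuclideanSpace ℝ (Fin d)) : 0 < gap f x ↔ x ∉ argminSet f := by
  obtain ⟨p, hp⟩ := hne
  rw [gap_eq_sub hp, sub_pos]
  constructor
  · exact fun h hx => absurd (hx p) (not_le.2 h)
  · exact fun h => lt_of_not_ge fun h' => h fun z => h'.trans (hp z)

theorem isClosed_argminSet {d : ℕ} {f : EuclideanSpace ℝ (Fin d) → ℝ} (hf : Continuous f) :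
    IsClosed (argminSet f) := by
  have : argminSet f = ⋂ y, {x | f x ≤ f y} := by ext; simp [argminSet]
  rw [this]
  exact isClosed_iInter fun y => isClosed_le hf continuous_const

theorem exists_mem_projSet {d : ℕ} {f : EuclideanSpace ℝ (Fin d) → ℝ} (hf : Continuous f)
    (hne : (argminSet f).Nonempty) (x : EuclideanSpace ℝ (Fin d)) :
    ∃ p ∈ projSet (argminSet f) x, ‖p - x‖ = Metric.infDist x (argminSet f) := by
  obtain ⟨p, hp, h⟩ := (isClosed_argminSet hf).exists_infDist_eq_dist hne x
  have h' : ‖p - x‖ = Metric.infDist x (argminSet f) := by rw [h, dist_comm, dist_eq_norm]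
  refine ⟨p, ⟨hp, fun z hz => ?_⟩, h'⟩
  rw [h', ← dist_eq_norm, dist_comm]
  exact Metric.infDist_le_dist_of_mem hz

theorem infDist_argminSet_le {d : ℕ} {f : EuclideanSpace ℝ (Fin d) → ℝ}
    {p : EuclideanSpace ℝ (Fin d)} (hp : p ∈ argminSet f) (x : EuclideanSpace ℝ (Fin d)) :
    Metric.infDist x (argminSet f) ≤ ‖x - p‖ := by
  rw [← dist_eq_norm]
  exact Metric.infDist_le_dist_of_mem hp

theorem gap_le_mul_infDist {d : ℕ} {f : EuclideanSpace ℝ (Fin d) → ℝ}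
    {g : EuclideanSpace ℝ (Fin d) → Set (EuclideanSpace ℝ (Fin d))}
    {xbar : EuclideanSpace ℝ (Fin d)} {δ L : ℝ} (hf : Continuous f) (hxbar : xbar ∈ argminSet f)
    (hL : IsLipBound f g xbar δ L) {x : EuclideanSpace ℝ (Fin d)} (hx : ‖x - xbar‖ < δ / 4) :
    gap f x ≤ L * Metric.infDist x (argminSet f) := by
  obtain ⟨p, ⟨hp, -⟩, hpx⟩ := exists_mem_projSet hf ⟨_, hxbar⟩ x
  have h0 := norm_nonneg (x - xbar)
  have h1 : ‖p - xbar‖ ≤ ‖p - x‖ + ‖x - xbar‖ := norm_sub_le_norm_sub_add_norm_sub _ _ _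
  have h2 := infDist_argminSet_le hxbar x
  have h3 := hL.2 x (mem_ball_iff_norm.2 (by linarith)) p (mem_ball_iff_norm.2 (by linarith))
  rw [gap_eq_sub hp, ← hpx, norm_sub_rev p x]
  exact (le_abs_self _).trans h3

theorem slope_le_lipBound {d : ℕ} {f : EuclideanSpace ℝ (Fin d) → ℝ}
    {g : EuclideanSpace ℝ (Fin d) → Set (EuclideanSpace ℝ (Fin d))}
    {xbar : EuclideanSpace ℝ (Fin d)} {δ μ L : ℝ} (hf : Continuous f) (hxbar : xbar ∈ argminSet f)
    (hsharp : Sharp f xbar δ μ) (hL : IsLipBound f g xbar δ L) {x : EuclideanSpace ℝ (Fin d)}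
    (hx : ‖x - xbar‖ < δ / 4) (hpos : 0 < Metric.infDist x (argminSet f)) : μ ≤ L := by
  have h0 := norm_nonneg (x - xbar)
  have h1 := hsharp x (mem_ball_iff_norm.2 (by linarith))
  have h2 := gap_le_mul_infDist hf hxbar hL hx
  exact le_of_mul_le_mul_right (h1.trans h2) hpos

/-! ### One call of the bundle procedure -/

/-- A bundle run from a point `x` at positive distance from the minimizers, close enough that
the errors of the linear models at points within `10 * dist x (argminSet f)` of the minimizers are
small compared with that distance. -/
structure IsLocalBundleRun {d : ℕ} (f : EuclideanSpace ℝ (Fin d) → ℝ)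
    (g : EuclideanSpace ℝ (Fin d) → Set (EuclideanSpace ℝ (Fin d)))
    (xbar : EuclideanSpace ℝ (Fin d)) (δ μ Cb η L : ℝ) (x : EuclideanSpace ℝ (Fin d))
    (y v : ℕ → EuclideanSpace ℝ (Fin d)) : Prop where
  cont : Continuous f
  mem_argmin : xbar ∈ argminSet f
  sharp : Sharp f xbar δ μ
  regular : BRegular f g xbar δ Cb η
  lip : IsLipBound f g xbar δ L
  slope_pos : 0 < μ
  slope_le : μ ≤ L
  const_pos : 0 < Cb
  order_pos : 0 < η
  run : IsBundleRun f g x y v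
  near : ‖x - xbar‖ < δ / 4
  dist_pos : 0 < Metric.infDist x (argminSet f)
  error_le : frameConst L (μ / 4) d *
    (Cb * (10 * Metric.infDist x (argminSet f)) ^ (1 + η)) ≤ 2 * Metric.infDist x (argminSet f)
  slope_error_le : Cb * (10 * Metric.infDist x (argminSet f)) ^ η ≤ μ / 2

namespace IsLocalBundleRun

variable {d : ℕ} {f : EuclideanSpace ℝ (Fin d) → ℝ}
  {g : EuclideanSpace ℝ (Fin d) → Set (EuclideanSpace ℝ (Fin d))}
  {xbar : EuclideanSpace ℝ (Fin d)} {δ μ Cb η L : ℝ} {x : EuclideanSpace ℝ (Fin d)}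
  {y v : ℕ → EuclideanSpace ℝ (Fin d)}

theorem model_error_nonneg (h : IsLocalBundleRun f g xbar δ μ Cb η L x y v) :
    0 ≤ Cb * (10 * Metric.infDist x (argminSet f)) ^ (1 + η) :=
  mul_nonneg h.const_pos.le (Real.rpow_nonneg (by linarith [h.dist_pos]) _)

theorem bound_nonneg (h : IsLocalBundleRun f g xbar δ μ Cb η L x y v) : 0 ≤ L :=
  h.slope_pos.le.trans h.slope_le

theorem infDist_lt (h : IsLocalBundleRun f g xbar δ μ Cb η L x y v) :
    Metric.infDist x (argminSet f) < δ / 4 :=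
  (infDist_argminSet_le h.mem_argmin x).trans_lt h.near

theorem mem_ball (h : IsLocalBundleRun f g xbar δ μ Cb η L x y v)
    {z : EuclideanSpace ℝ (Fin d)} (hz : ‖z - x‖ ≤ 3 * Metric.infDist x (argminSet f)) :
    z ∈ Metric.ball xbar δ := by
  have h1 : ‖z - xbar‖ ≤ ‖z - x‖ + ‖x - xbar‖ := norm_sub_le_norm_sub_add_norm_sub _ _ _
  exact mem_ball_iff_norm.2 (by linarith [h.infDist_lt, h.near])

theorem model_error_le (h : IsLocalBundleRun f g xbar δ μ Cb η L x y v) {j : ℕ} (hj : j < d)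
    (hyj : ‖y j - x‖ ≤ 3 * Metric.infDist x (argminSet f)) {q : EuclideanSpace ℝ (Fin d)}
    (hq : q ∈ argminSet f) (hqb : q ∈ Metric.ball xbar (2 * δ))
    (hqy : ‖q - y j‖ ≤ 10 * Metric.infDist x (argminSet f)) :
    |gap f (y j) + inner ℝ (v j) (q - y j)| ≤
      Cb * (10 * Metric.infDist x (argminSet f)) ^ (1 + η) := by
  refine (h.regular (y j) (h.mem_ball hyj) (v j) (h.run.2.1 j hj) q ⟨hq, hqb⟩).trans ?_
  exact mul_le_mul_of_nonneg_left
    (Real.rpow_le_rpow (norm_nonneg _) hqy (by linarith [h.order_pos])) h.const_pos.le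

/-- With independent rows, `y i` is a common zero of the linear models at `y 0, …, y (i - 1)`. -/
theorem model_eq_zero (h : IsLocalBundleRun f g xbar δ μ Cb η L x y v) {i : ℕ} (hi : i ≤ d)
    (hsep : IsSeparated (μ / 4) v i) {j : ℕ} (hj : j < i) :
    gap f (y j) + inner ℝ (v j) (y i - y j) = 0 := by
  have hli := hsep.linearIndependent (by linarith [h.slope_pos])
  have h1 := inner_eq_bundleMatrix_mulVec v i (pinv (bundleMatrix v i) *ᵥ bundleVector f y v i)
    ⟨j, hj⟩
  rw [bundleMatrix_mulVec_pinv hli] at h1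
  have h2 := h.run.2.2 i (Finset.mem_Icc.2 ⟨by omega, hi⟩)
  have h3 : y i - y j = (y 0 - y j) -
      WithLp.toLp 2 (pinv (bundleMatrix v i) *ᵥ bundleVector f y v i) := by
    rw [h2]; abel
  rw [h3, inner_sub_right]
  simp only [bundleVector] at h1
  linarith

theorem sub_mem_initialSpan (h : IsLocalBundleRun f g xbar δ μ Cb η L x y v) {i : ℕ}
    (hi : i ≤ d) : y i - x ∈ initialSpan v i := by
  rcases Nat.eq_zero_or_pos i with rfl | hpos
  · rw [h.run.1, sub_self]
    exact zero_mem _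
  · have h2 := h.run.2.2 i (Finset.mem_Icc.2 ⟨hpos, hi⟩)
    have h3 : y i - x = -WithLp.toLp 2 (pinv (bundleMatrix v i) *ᵥ bundleVector f y v i) := by
      rw [h2, h.run.1]; abel
    rw [h3]
    exact neg_mem (toLp_pinv_mulVec_mem v i _)

/-- The differences between `y i` and the nearby minimizers are almost orthogonal to
`v 0, …, v (i - 1)`. -/
theorem abs_inner_sub_le (h : IsLocalBundleRun f g xbar δ μ Cb η L x y v) {i : ℕ} (hi : i ≤ d)
    (hsep : IsSeparated (μ / 4) v i)
    (hy : ∀ j < i, ‖y j - x‖ ≤ 3 * Metric.infDist x (argminSet f)) {q : EuclideanSpace ℝ (Fin d)}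
    (hq : q ∈ argminSet f) (hqb : q ∈ Metric.ball xbar (2 * δ))
    (hqx : ‖q - x‖ ≤ 7 * Metric.infDist x (argminSet f)) {j : ℕ} (hj : j < i) :
    |inner ℝ (v j) (y i - q)| ≤ Cb * (10 * Metric.infDist x (argminSet f)) ^ (1 + η) := by
  have h1 : ‖q - y j‖ ≤ ‖q - x‖ + ‖x - y j‖ := norm_sub_le_norm_sub_add_norm_sub _ _ _
  rw [norm_sub_rev x] at h1
  have h2 := h.model_error_le (hj.trans_le hi) (hy j hj) hq hqb (by linarith [hy j hj])
  have h3 := h.model_eq_zero hi hsep hj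
  have h4 : inner ℝ (v j) (y i - q) = -(gap f (y j) + inner ℝ (v j) (q - y j)) := by
    have : y i - q = (y i - y j) - (q - y j) := by abel
    rw [this, inner_sub_right]
    linarith
  rwa [h4, abs_neg]

theorem frameConst_mul_le (h : IsLocalBundleRun f g xbar δ μ Cb η L x y v) {i : ℕ} (hi : i ≤ d) :
    frameConst L (μ / 4) i * (Cb * (10 * Metric.infDist x (argminSet f)) ^ (1 + η)) ≤
      frameConst L (μ / 4) d * (Cb * (10 * Metric.infDist x (argminSet f)) ^ (1 + η)) :=
  mul_le_mul_of_nonneg_right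
    (frameConst_mono h.bound_nonneg (by linarith [h.slope_pos]) hi) h.model_error_nonneg

theorem norm_le_of_mem_ball (h : IsLocalBundleRun f g xbar δ μ Cb η L x y v) {i : ℕ} (hi : i ≤ d)
    (hy : ∀ j < i, ‖y j - x‖ ≤ 3 * Metric.infDist x (argminSet f)) {j : ℕ} (hj : j < i) :
    ‖v j‖ ≤ L :=
  h.lip.1 (y j) (h.mem_ball (hy j hj)) (v j) (h.run.2.1 j (hj.trans_le hi))

theorem exists_nearest (h : IsLocalBundleRun f g xbar δ μ Cb η L x y v)
    {z : EuclideanSpace ℝ (Fin d)} (hz : ‖z - x‖ ≤ 3 * Metric.infDist x (argminSet f)) :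
    ∃ q ∈ argminSet f, q ∈ Metric.ball xbar (2 * δ) ∧
      ‖q - z‖ = Metric.infDist z (argminSet f) ∧
      ‖q - z‖ ≤ 4 * Metric.infDist x (argminSet f) := by
  obtain ⟨p, ⟨hp, -⟩, hpx⟩ := exists_mem_projSet h.cont ⟨_, h.mem_argmin⟩ x
  obtain ⟨q, ⟨hq, hmin⟩, hqz⟩ := exists_mem_projSet h.cont ⟨_, h.mem_argmin⟩ z
  have hzb := mem_ball_iff_norm.1 (h.mem_ball hz)
  have h1 := hmin _ h.mem_argmin
  rw [norm_sub_rev xbar z] at h1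
  have h2 : ‖q - xbar‖ ≤ ‖q - z‖ + ‖z - xbar‖ := norm_sub_le_norm_sub_add_norm_sub _ _ _
  have h3 : ‖p - z‖ ≤ ‖p - x‖ + ‖x - z‖ := norm_sub_le_norm_sub_add_norm_sub _ _ _
  rw [norm_sub_rev x z] at h3
  exact ⟨q, hq, mem_ball_iff_norm.2 (by linarith), hqz, by linarith [hmin p hp]⟩

/-- As long as the gradients are separated, the next point stays close to `x`. -/
theorem norm_sub_le (h : IsLocalBundleRun f g xbar δ μ Cb η L x y v) {i : ℕ} (hi : i ≤ d)
    (hsep : IsSeparated (μ / 4) v i)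
    (hy : ∀ j < i, ‖y j - x‖ ≤ 3 * Metric.infDist x (argminSet f)) :
    ‖y i - x‖ ≤ 3 * Metric.infDist x (argminSet f) := by
  have hD := h.dist_pos
  obtain ⟨p, hp, hpb, hpx, -⟩ := h.exists_nearest (z := x) (by simp; linarith)
  have h1 := hsep.norm_starProjection_le h.bound_nonneg (by linarith [h.slope_pos])
    (fun j hj => h.norm_le_of_mem_ball hi hy hj)
    (fun j hj => h.abs_inner_sub_le hi hsep hy hp hpb (by linarith) hj)
  have h2 : y i - x = (initialSpan v i).starProjection (y i - p) +
      (initialSpan v i).starProjection (p - x) := by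
    rw [← map_add, sub_add_sub_cancel,
      Submodule.starProjection_eq_self_iff.2 (h.sub_mem_initialSpan hi)]
  have h3 : ‖(initialSpan v i).starProjection (p - x)‖ ≤ ‖p - x‖ :=
    Submodule.norm_starProjection_apply_le _ _
  rw [h2]
  refine (norm_add_le _ _).trans ?_
  linarith [h.frameConst_mul_le hi, h.error_le]

/-- If `y i` has not yet reached a superlinearly small gap, then `v i` is separated from the
span of its predecessors: it has a large inner product with the difference between `y i` and its
nearest minimizer, while that difference is almost orthogonal to the predecessors. -/
theorem isSeparated_succ (h : IsLocalBundleRun f g xbar δ μ Cb η L x y v) {i : ℕ} (hi : i < d)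
    (hsep : IsSeparated (μ / 4) v i)
    (hy : ∀ j ≤ i, ‖y j - x‖ ≤ 3 * Metric.infDist x (argminSet f)) (hpos : 0 < gap f (y i))
    (hgap : 4 * L * (frameConst L (μ / 4) i *
      (Cb * (10 * Metric.infDist x (argminSet f)) ^ (1 + η))) ≤ gap f (y i)) :
    IsSeparated (μ / 4) v (i + 1) := by
  have hD := h.dist_pos
  have hμ := h.slope_pos
  have hη := h.order_pos
  have hy' : ∀ j < i, ‖y j - x‖ ≤ 3 * Metric.infDist x (argminSet f) := fun j hj => hy j hj.le
  intro j hj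
  rcases Nat.lt_succ_iff_lt_or_eq.1 hj with hji | rfl
  · exact hsep j hji
  intro w hw
  obtain ⟨q, hq, hqb, hqz, hq4⟩ := h.exists_nearest (hy j le_rfl)
  have hjb := h.mem_ball (hy j le_rfl)
  have hqx : ‖q - x‖ ≤ ‖q - y j‖ + ‖y j - x‖ := norm_sub_le_norm_sub_add_norm_sub _ _ _
  have hyj := hy j le_rfl
  set E := ‖q - y j‖ with hE
  have hE0 : 0 ≤ E := norm_nonneg _
  have hsh : μ * E ≤ gap f (y j) := by rw [hqz]; exact h.sharp _ hjb
  have h1 : inner ℝ (v j) (y j - q) ≥ gap f (y j) / 2 := by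
    have e1 := (abs_le.1 (h.regular (y j) hjb (v j) (h.run.2.1 j hi) q ⟨hq, hqb⟩)).2
    have e2 : E ^ (1 + η) ≤ E * (10 * Metric.infDist x (argminSet f)) ^ η := by
      rw [Real.rpow_add_of_nonneg hE0 zero_le_one hη.le, Real.rpow_one]
      gcongr
      linarith
    have e3 : Cb * E ^ (1 + η) ≤ gap f (y j) / 2 := by
      calc Cb * E ^ (1 + η) ≤ Cb * (E * (10 * Metric.infDist x (argminSet f)) ^ η) :=
            mul_le_mul_of_nonneg_left e2 h.const_pos.le
        _ = E * (Cb * (10 * Metric.infDist x (argminSet f)) ^ η) := by ring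
        _ ≤ E * (μ / 2) := mul_le_mul_of_nonneg_left h.slope_error_le hE0
        _ ≤ gap f (y j) / 2 := by linarith
    have e4 : inner ℝ (v j) (y j - q) = -inner ℝ (v j) (q - y j) := by
      rw [← inner_neg_right, neg_sub]
    linarith
  set P := (initialSpan v j).starProjection with hP
  have h2 : ‖P (y j - q)‖ ≤ frameConst L (μ / 4) j *
      (Cb * (10 * Metric.infDist x (argminSet f)) ^ (1 + η)) :=
    hsep.norm_starProjection_le h.bound_nonneg (by linarith)
      (fun k hk => h.norm_le_of_mem_ball hi.le hy' hk)
      (fun k hk => h.abs_inner_sub_le hi.le hsep hy' hq hqb (by linarith) hk)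
  have h3 : inner ℝ (v j) (P (y j - q)) ≤ gap f (y j) / 4 := by
    have e1 : inner ℝ (v j) (P (y j - q)) ≤ ‖v j‖ * ‖P (y j - q)‖ := real_inner_le_norm _ _
    have e2 := h.lip.1 (y j) hjb (v j) (h.run.2.1 j hi)
    have e3 := mul_le_mul e2 h2 (norm_nonneg _) h.bound_nonneg
    linarith
  -- Only the component orthogonal to the span is left, and it does not see `w`.
  have h4 : inner ℝ (v j) (y j - q - P (y j - q)) = inner ℝ (v j - w) (y j - q - P (y j - q)) := by
    rw [inner_sub_left (v j) w, (Submodule.mem_orthogonal _ _).1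
      (Submodule.sub_starProjection_mem_orthogonal (y j - q)) w hw, sub_zero]
  have h5 : ‖y j - q - P (y j - q)‖ ≤ E := by
    rw [hE, norm_sub_rev q]
    have := Submodule.norm_starProjection_apply_le (initialSpan v j)ᗮ (y j - q)
    rwa [Submodule.starProjection_orthogonal_val] at this
  have h6 : gap f (y j) / 4 ≤ ‖v j - w‖ * E := by
    calc gap f (y j) / 4 ≤ inner ℝ (v j) (y j - q - P (y j - q)) := by
          rw [inner_sub_right]; linarith
      _ ≤ ‖v j - w‖ * ‖y j - q - P (y j - q)‖ := by rw [h4]; exact real_inner_le_norm _ _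
      _ ≤ _ := mul_le_mul_of_nonneg_left h5 (norm_nonneg _)
  by_contra! hlt
  have h7 : E ≠ 0 := by
    rintro h0
    rw [h0] at h6
    linarith
  have h8 := mul_lt_mul_of_pos_right hlt (lt_of_le_of_ne hE0 (Ne.symm h7))
  linarith

/-- Some point of the run is within three distances of `x` and has a superlinearly small gap. -/
theorem exists_small_gap (h : IsLocalBundleRun f g xbar δ μ Cb η L x y v) (hd : 0 < d) :
    ∃ i ∈ Finset.Icc 1 d, ‖y i - x‖ ≤ 3 * Metric.infDist x (argminSet f) ∧
      gap f (y i) ≤ 4 * L * (frameConst L (μ / 4) d *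
        (Cb * (10 * Metric.infDist x (argminSet f)) ^ (1 + η))) := by
  have hD := h.dist_pos
  have hμ := h.slope_pos
  have hL := h.bound_nonneg
  have ht := h.model_error_nonneg
  have hC := frameConst_nonneg hL (show 0 < μ / 4 by linarith) d
  by_contra! hno
  have key : ∀ i ≤ d, IsSeparated (μ / 4) v i ∧
      ∀ j ≤ i, ‖y j - x‖ ≤ 3 * Metric.infDist x (argminSet f) := by
    intro i
    induction i with
    | zero =>
      refine fun _ => ⟨fun j hj => absurd hj (Nat.not_lt_zero j), fun j hj => ?_⟩
      rw [Nat.le_zero.1 hj, h.run.1, sub_self, norm_zero]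
      linarith
    | succ i ih =>
      intro hi
      obtain ⟨hsep, hy⟩ := ih (by omega)
      have hs : IsSeparated (μ / 4) v (i + 1) := by
        rcases Nat.eq_zero_or_pos i with rfl | hpos
        · -- For `i = 0` there are no predecessors: `frameConst L (μ / 4) 0 = 0`.
          have e1 : 0 < gap f (y 0) := by
            rw [h.run.1]
            refine lt_of_lt_of_le (mul_pos hμ hD) (h.sharp x (h.mem_ball ?_))
            rw [sub_self, norm_zero]; linarith
          exact h.isSeparated_succ (by omega) hsep hy e1 (by simpa [frameConst] using e1.le)
        · have e1 := hno i (Finset.mem_Icc.2 ⟨hpos, by omega⟩) (hy i le_rfl)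
          have e2 := mul_le_mul_of_nonneg_left (h.frameConst_mul_le (show i ≤ d by omega))
            (show 0 ≤ 4 * L by linarith)
          exact h.isSeparated_succ (by omega) hsep hy
            (lt_of_le_of_lt (by positivity) e1) (e2.trans e1.le)
      have hn := h.norm_sub_le hi hs fun j hj => hy j (Nat.lt_succ_iff.1 hj)
      refine ⟨hs, fun j hj => ?_⟩
      rcases Nat.le_succ_iff.1 hj with hj | rfl
      · exact hy j hj
      · exact hn
  obtain ⟨hsep, hy⟩ := key d le_rfl
  -- After `d` separated gradients there is no orthogonal complement left, so `y d` is close to the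
  -- minimizer nearest to `x`.
  obtain ⟨p, hp, hpb, hpx, -⟩ := h.exists_nearest (z := x) (by simp; linarith)
  have h1 := hsep.norm_le hL (by linarith)
    (fun j hj => h.norm_le_of_mem_ball le_rfl (fun j hj => hy j hj.le) hj)
    (w := y d - p) (by rw [hsep.initialSpan_eq_top (by linarith)]; exact Submodule.mem_top)
    (fun j hj => h.abs_inner_sub_le le_rfl hsep (fun j hj => hy j hj.le) hp hpb (by linarith) hj)
  have h2 := h.lip.2 (y d) (h.mem_ball (hy d le_rfl)) p (h.mem_ball (by linarith))
  have h3 := mul_le_mul_of_nonneg_left h1 hL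
  have h4 := hno d (Finset.mem_Icc.2 ⟨hd, le_rfl⟩) (hy d le_rfl)
  rw [gap_eq_sub hp] at h4
  have h5 := le_abs_self (f (y d) - f p)
  have h6 : 0 ≤ L * (frameConst L (μ / 4) d *
    (Cb * (10 * Metric.infDist x (argminSet f)) ^ (1 + η))) := by positivity
  linarith

end IsLocalBundleRun

/-! ### The constant of superlinear improvement -/

/-- A bound on the `η`-th power of the distance to the minimizers below which the errors of the
linear models are negligible. The argument `L` stands for a bound that is at least `μ`. -/
def smallness (d : ℕ) (μ Cb η L : ℝ) : ℝ :=
  min (1 / (frameConst L (μ / 4) d * Cb * 10 ^ (1 + η) + 1)) (μ / (2 * (Cb * 10 ^ (1 + η))))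

/-- The constant of superlinear improvement. If some point of the ball is not a minimizer, then
`μ ≤ L`; `max L μ` replaces `L` so that the constant is meaningful in every case. -/
def improvementConst (d : ℕ) (μ Cb η L : ℝ) : ℝ :=
  max (1 / 2) (max
    (4 * max L μ * (frameConst (max L μ) (μ / 4) d * (Cb * 10 ^ (1 + η))) / μ ^ (1 + η))
    (μ ^ (1 - η) / (max L μ * smallness d μ Cb η (max L μ))))

theorem half_le_improvementConst (d : ℕ) (μ Cb η L : ℝ) :
    1 / 2 ≤ improvementConst d μ Cb η L :=
  le_max_left _ _

theorem improvementConst_pos (d : ℕ) (μ Cb η L : ℝ) : 0 < improvementConst d μ Cb η L :=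
  lt_of_lt_of_le (by norm_num) (half_le_improvementConst d μ Cb η L)

theorem smallness_pos {d : ℕ} {μ Cb η L : ℝ} (hμ : 0 < μ) (hCb : 0 < Cb) (hL : 0 ≤ L) :
    0 < smallness d μ Cb η L := by
  have := frameConst_nonneg hL (show 0 < μ / 4 by linarith) d
  unfold smallness
  positivity

theorem rpow_infDist_le_smallness {d : ℕ} {μ Cb η L D : ℝ} (hμ : 0 < μ) (hCb : 0 < Cb)
    (hη : 0 < η) (hL : μ ≤ L) (hD : 0 ≤ D)
    (hDle : D ≤ (μ ^ (1 - η) / (L * improvementConst d μ Cb η L)) ^ (1 / η)) :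
    D ^ η ≤ smallness d μ Cb η L := by
  have hL0 : 0 < L := hμ.trans_le hL
  have hs := smallness_pos (d := d) (η := η) hμ hCb hL0.le
  have hC := improvementConst_pos d μ Cb η L
  have h1 : D ^ η ≤ μ ^ (1 - η) / (L * improvementConst d μ Cb η L) := by
    have := Real.rpow_le_rpow hD hDle hη.le
    rwa [← Real.rpow_mul (by positivity), one_div_mul_cancel hη.ne', Real.rpow_one] at this
  refine h1.trans ((div_le_iff₀ (by positivity)).2 ?_)
  have h2 : μ ^ (1 - η) / (L * smallness d μ Cb η L) ≤ improvementConst d μ Cb η L := by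
    have : μ ^ (1 - η) / (max L μ * smallness d μ Cb η (max L μ)) ≤ improvementConst d μ Cb η L :=
      (le_max_right _ _).trans (le_max_right _ _)
    rwa [max_eq_left hL] at this
  have h3 := (div_le_iff₀ (by positivity)).1 h2
  linarith

/-- Near `xbar`, every bundle run contains an admissible point of superlinearly small gap. -/
theorem exists_admissible_small_gap {d : ℕ} (hd : 0 < d) {μ Cb η L : ℝ} (hμ : 0 < μ)
    (hCb : 0 < Cb) (hη : 0 < η) {f : EuclideanSpace ℝ (Fin d) → ℝ}
    {g : EuclideanSpace ℝ (Fin d) → Set (EuclideanSpace ℝ (Fin d))}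
    {xbar : EuclideanSpace ℝ (Fin d)} {δ : ℝ} (hf : Continuous f) (hxbar : xbar ∈ argminSet f)
    (hsharp : Sharp f xbar δ μ) (hreg : BRegular f g xbar δ Cb η) (hL : IsLipBound f g xbar δ L)
    {τ : ℝ} (hτ : 3 / μ ≤ τ) {x : EuclideanSpace ℝ (Fin d)} (hx : ‖x - xbar‖ < δ / 4)
    (hD : Metric.infDist x (argminSet f) ≤
      (μ ^ (1 - η) / (L * improvementConst d μ Cb η L)) ^ (1 / η))
    {y v : ℕ → EuclideanSpace ℝ (Fin d)} (hrun : IsBundleRun f g x y v) :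
    ∃ i ∈ admissible f τ y, gap f (y i) ≤ improvementConst d μ Cb η L * gap f x ^ (1 + η) := by
  have hxδ : x ∈ Metric.ball xbar δ := by
    have := norm_nonneg (x - xbar)
    exact mem_ball_iff_norm.2 (by linarith)
  have hgr := hsharp x hxδ
  have hgx := gap_nonneg ⟨_, hxbar⟩ x
  rcases (Metric.infDist_nonneg (x := x) (s := argminSet f)).eq_or_lt with h0 | hpos
  · -- At a minimizer the first right-hand side vanishes, so the run does not move.
    have hxmem : x ∈ argminSet f :=
      ((isClosed_argminSet hf).mem_iff_infDist_zero ⟨_, hxbar⟩).2 h0.symm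
    have hg0 : gap f x = 0 := by rw [gap_eq_sub hxmem, sub_self]
    have hb : bundleVector f y v 1 = 0 := by
      funext j
      simp [bundleVector, hrun.1, hg0]
    have hy1 : y 1 = x := by
      have := hrun.2.2 1 (Finset.mem_Icc.2 ⟨le_rfl, hd⟩)
      rwa [hb, Matrix.mulVec_zero, WithLp.toLp_zero, sub_zero, hrun.1] at this
    refine ⟨1, ⟨Finset.mem_Icc.2 ⟨le_rfl, hd⟩, ?_⟩, ?_⟩
    · simp [hy1, hrun.1, hg0]
    · rw [hy1, hg0, Real.zero_rpow (by linarith), mul_zero]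
  · have hLμ := slope_le_lipBound hf hxbar hsharp hL hx hpos
    have hL0 : 0 < L := hμ.trans_le hLμ
    set D := Metric.infDist x (argminSet f) with hDdef
    have hM := frameConst_nonneg hL0.le (show 0 < μ / 4 by linarith) d
    set M := frameConst L (μ / 4) d with hMdef
    have hsm := rpow_infDist_le_smallness hμ hCb hη hLμ hpos.le hD
    have hq : (0 : ℝ) < 10 ^ (1 + η) := by positivity
    have hpow : (10 * D) ^ (1 + η) = 10 ^ (1 + η) * (D ^ η * D) := by
      rw [Real.mul_rpow (by norm_num) hpos.le, add_comm 1 η, Real.rpow_add hpos, Real.rpow_one]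
    have herr : M * (Cb * (10 * D) ^ (1 + η)) ≤ 2 * D := by
      have e1 : D ^ η ≤ 1 / (M * Cb * 10 ^ (1 + η) + 1) := hsm.trans (min_le_left _ _)
      have e2 := (le_div_iff₀ (by positivity)).1 e1
      have e3 := Real.rpow_nonneg hpos.le η
      have e4 : M * Cb * 10 ^ (1 + η) * D ^ η ≤ 1 := by linarith
      have e5 := mul_le_mul_of_nonneg_right e4 hpos.le
      rw [hpow]
      linarith
    have hslope : Cb * (10 * D) ^ η ≤ μ / 2 := by
      have e1 : D ^ η ≤ μ / (2 * (Cb * 10 ^ (1 + η))) := hsm.trans (min_le_right _ _)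
      have e2 := (le_div_iff₀ (by positivity)).1 e1
      have e3 := Real.rpow_nonneg hpos.le η
      have e4 : (10 : ℝ) ^ η ≤ 10 ^ (1 + η) :=
        Real.rpow_le_rpow_of_exponent_le (by norm_num) (by linarith)
      have e5 : Cb * (10 ^ η * D ^ η) ≤ Cb * (10 ^ (1 + η) * D ^ η) := by gcongr
      rw [Real.mul_rpow (by norm_num) hpos.le]
      linarith
    have hloc : IsLocalBundleRun f g xbar δ μ Cb η L x y v :=
      ⟨hf, hxbar, hsharp, hreg, hL, hμ, hLμ, hCb, hη, hrun, hx, hpos, herr, hslope⟩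
    obtain ⟨i, hi, hix, hgap⟩ := hloc.exists_small_gap hd
    refine ⟨i, ⟨hi, ?_⟩, hgap.trans ?_⟩
    · rw [hrun.1]
      calc ‖y i - x‖ ≤ 3 * D := hix
        _ = 3 / μ * (μ * D) := by field_simp
        _ ≤ 3 / μ * gap f x := by gcongr
        _ ≤ τ * gap f x := by gcongr
    · have hDμ : D ≤ gap f x / μ := by rw [le_div_iff₀ hμ]; linarith
      have e1 : (10 * D) ^ (1 + η) ≤ 10 ^ (1 + η) * (gap f x ^ (1 + η) / μ ^ (1 + η)) := by
        rw [Real.mul_rpow (by norm_num) hpos.le, ← Real.div_rpow hgx hμ.le]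
        gcongr
      have e2 : 4 * L * (M * (Cb * 10 ^ (1 + η))) / μ ^ (1 + η) ≤ improvementConst d μ Cb η L := by
        have := (le_max_left (4 * max L μ * (frameConst (max L μ) (μ / 4) d *
          (Cb * 10 ^ (1 + η))) / μ ^ (1 + η)) _).trans (le_max_right (1 / 2)
          (max _ (μ ^ (1 - η) / (max L μ * smallness d μ Cb η (max L μ)))))
        rwa [← improvementConst, max_eq_left hLμ] at this
      calc 4 * L * (M * (Cb * (10 * D) ^ (1 + η)))
          ≤ 4 * L * (M * (Cb * (10 ^ (1 + η) * (gap f x ^ (1 + η) / μ ^ (1 + η))))) := by gcongr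
        _ = 4 * L * (M * (Cb * 10 ^ (1 + η))) / μ ^ (1 + η) * gap f x ^ (1 + η) := by ring
        _ ≤ _ := by gcongr

/-- Superlinear improvement. The threshold `τ = 3 / μ` is included, since the burn-in period
guarantees only `3 / μ ≤ (3 / 2) ^ k`. -/
theorem exists_eq_some_of_polyakBundle {d : ℕ} (hd : 0 < d) {μ Cb η L : ℝ} (hμ : 0 < μ)
    (hCb : 0 < Cb) (hη : 0 < η) {f : EuclideanSpace ℝ (Fin d) → ℝ}
    {g : EuclideanSpace ℝ (Fin d) → Set (EuclideanSpace ℝ (Fin d))}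
    {xbar : EuclideanSpace ℝ (Fin d)} {δ : ℝ} (hf : Continuous f) (hxbar : xbar ∈ argminSet f)
    (hsharp : Sharp f xbar δ μ) (hreg : BRegular f g xbar δ Cb η) (hL : IsLipBound f g xbar δ L)
    {τ : ℝ} (hτ : 3 / μ ≤ τ) {x : EuclideanSpace ℝ (Fin d)} (hx : ‖x - xbar‖ < δ / 4)
    (hD : Metric.infDist x (argminSet f) ≤
      (μ ^ (1 - η) / (L * improvementConst d μ Cb η L)) ^ (1 / η))
    {r : Option (EuclideanSpace ℝ (Fin d))} (hr : PolyakBundle f g x τ r) :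
    ∃ xt, r = some xt ∧ gap f xt ≤ improvementConst d μ Cb η L * gap f x ^ (1 + η) := by
  cases hr with
  | empty y v hrun hnone =>
    obtain ⟨i, hi, -⟩ :=
      exists_admissible_small_gap hd hμ hCb hη hf hxbar hsharp hreg hL hτ hx hD hrun
    rw [hnone] at hi
    exact absurd hi (Set.notMem_empty i)
  | point y v hrun s hs hmin =>
    obtain ⟨i, hi, hgap⟩ :=
      exists_admissible_small_gap hd hμ hCb hη hf hxbar hsharp hreg hL hτ hx hD hrun
    refine ⟨y s, rfl, le_trans ?_ hgap⟩
    rw [gap_eq_sub hxbar, gap_eq_sub hxbar]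
    exact sub_le_sub_right (hmin i hi) _

/-! ### Existence of bundle runs -/

/-- The points of a bundle run from `x` with gradients `v j = σ (y j)`. The function
`bundleHistory f σ x i` takes the values `y 0, …, y i` at `0, …, i` and the junk value `x` at larger
indices, so that `y (i + 1)` is obtained by one `Function.update`. -/
def bundleHistory {d : ℕ} (f : EuclideanSpace ℝ (Fin d) → ℝ)
    (σ : EuclideanSpace ℝ (Fin d) → EuclideanSpace ℝ (Fin d)) (x : EuclideanSpace ℝ (Fin d)) :
    ℕ → ℕ → EuclideanSpace ℝ (Fin d)
  | 0 => fun _ => x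
  | i + 1 => Function.update (bundleHistory f σ x i) (i + 1)
      (x - WithLp.toLp 2 (pinv (bundleMatrix (σ ∘ bundleHistory f σ x i) (i + 1)) *ᵥ
        bundleVector f (bundleHistory f σ x i) (σ ∘ bundleHistory f σ x i) (i + 1)))

theorem bundleHistory_eq {d : ℕ} (f : EuclideanSpace ℝ (Fin d) → ℝ)
    (σ : EuclideanSpace ℝ (Fin d) → EuclideanSpace ℝ (Fin d)) (x : EuclideanSpace ℝ (Fin d))
    {i j : ℕ} (h : j ≤ i) : bundleHistory f σ x i j = bundleHistory f σ x j j := by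
  induction i, h using Nat.le_induction with
  | base => rfl
  | succ i hij ih =>
    rw [bundleHistory, Function.update_of_ne (by omega), ih]

theorem exists_isBundleRun {d : ℕ} (f : EuclideanSpace ℝ (Fin d) → ℝ)
    {g : EuclideanSpace ℝ (Fin d) → Set (EuclideanSpace ℝ (Fin d))} (hg : ∀ x, (g x).Nonempty)
    (x : EuclideanSpace ℝ (Fin d)) : ∃ y v, IsBundleRun f g x y v := by
  choose σ hσ using hg
  refine ⟨fun i => bundleHistory f σ x i i, fun i => σ (bundleHistory f σ x i i), rfl,
    fun i _ => hσ _, fun i hi => ?_⟩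
  obtain ⟨k, rfl⟩ : ∃ k, i = k + 1 := ⟨i - 1, by have := (Finset.mem_Icc.1 hi).1; omega⟩
  have hj : ∀ j : Fin (k + 1), bundleHistory f σ x k j = bundleHistory f σ x j j := fun j =>
    bundleHistory_eq f σ x (Nat.lt_succ_iff.1 j.2)
  have h0 : bundleHistory f σ x k 0 = x := bundleHistory_eq f σ x (Nat.zero_le k)
  have hA : bundleMatrix (σ ∘ bundleHistory f σ x k) (k + 1) =
      bundleMatrix (fun i => σ (bundleHistory f σ x i i)) (k + 1) := by
    ext j c
    simp [bundleMatrix, hj]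
  have hb : bundleVector f (bundleHistory f σ x k) (σ ∘ bundleHistory f σ x k) (k + 1) =
      bundleVector f (fun i => bundleHistory f σ x i i)
        (fun i => σ (bundleHistory f σ x i i)) (k + 1) := by
    funext j
    simp [bundleVector, hj, h0, bundleHistory]
  rw [← hA, ← hb]
  exact Function.update_self _ _ _

theorem exists_polyakBundle {d : ℕ} (f : EuclideanSpace ℝ (Fin d) → ℝ)
    {g : EuclideanSpace ℝ (Fin d) → Set (EuclideanSpace ℝ (Fin d))} (hg : ∀ x, (g x).Nonempty)
    (x : EuclideanSpace ℝ (Fin d)) (τ : ℝ) : ∃ r, PolyakBundle f g x τ r := by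
  obtain ⟨y, v, hrun⟩ := exists_isBundleRun f hg x
  rcases (admissible f τ y).eq_empty_or_nonempty with h | h
  · exact ⟨none, .empty y v hrun h⟩
  · have hfin : (admissible f τ y).Finite :=
      (Finset.Icc 1 d).finite_toSet.subset fun i hi => hi.1
    obtain ⟨s, hs, hmin⟩ := Set.exists_min_image _ (fun i => f (y i)) hfin h
    exact ⟨some (y s), .point y v hrun s hs hmin⟩

/-! ### Invariants of the coupled algorithm -/

/-- A bound on the total length of the steps from outer iteration `k` on. Accepted bundle steps have
length at most `Δ (3/4)^k`, and the fallback of iteration `k` moves by at most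
`(1 + ρ)/(1 - ρ) · Δ/μ · (1/2)^k`. -/
def remainingTravel (μ ρ Δ : ℝ) (k : ℕ) : ℝ :=
  4 * Δ * (3 / 4) ^ k + 2 * ((1 + ρ) / (1 - ρ) * (Δ / μ)) * (1 / 2) ^ k

/-- Everything that the analysis of the coupled algorithm uses. The outer iterates stay within `m`
of `xbar`, `K` outer iterations are made before bundle steps are always accepted, `NA` evaluations
suffice for one fallback, and the function gap at iteration `K + j` is at most
`σ (1/2)^((1 + η)^j)`, which for `j = N` does not exceed `ε`. -/
structure IsCoupledRegime {d : ℕ} (f : EuclideanSpace ℝ (Fin d) → ℝ)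
    (g : EuclideanSpace ℝ (Fin d) → Set (EuclideanSpace ℝ (Fin d)))
    (xbar : EuclideanSpace ℝ (Fin d)) (φ₁ φ₂ : ℝ)
    (A : Metric.ball xbar φ₁ → EuclideanSpace ℝ (Fin d)) (μ L ρ η Cs σ Δ m ε : ℝ)
    (K NA N : ℕ) : Prop where
  dim_pos : 0 < d
  cont : Continuous f
  nonempty : (argminSet f).Nonempty
  grad_nonempty : ∀ x, (g x).Nonempty
  slope_pos : 0 < μ
  slope_le : μ ≤ L
  order_pos : 0 < η
  const_pos : 0 < Cs
  scale_pos : 0 < σ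
  scale_le : Cs * σ ^ η ≤ 1 / 2
  rate_pos : 0 < ρ
  rate_lt : ρ < 1
  radius_le : m ≤ φ₁
  growth : ∀ z, ‖z - xbar‖ < m → μ * Metric.infDist z (argminSet f) ≤ gap f z
  lipschitz : ∀ z, ‖z - xbar‖ < m → gap f z ≤ L * Metric.infDist z (argminSet f)
  algorithm : IsAlgorithmicMapping f xbar φ₁ φ₂ ρ A
  bundle : ∀ k, K ≤ k → ∀ x, ‖x - xbar‖ < m → gap f x ≤ Δ * (1 / 2) ^ k →
    ∀ r, PolyakBundle f g x ((3 / 2) ^ k) r →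
      ∃ xt, r = some xt ∧ gap f xt ≤ Cs * gap f x ^ (1 + η)
  initialGap_small : Δ / μ < φ₂
  initialGap_nonneg : 0 ≤ Δ
  burnIn_le : Δ * (1 / 2) ^ K ≤ σ * (1 / 2)
  fallback_pos : 0 < NA
  fallback_le : L / μ * ρ ^ NA ≤ 1 / 2
  tail_le : σ * (1 / 2) ^ ((1 + η) ^ N) ≤ ε

/-- What is known about the iterate of outer iteration `k`. -/
structure IsOuterIterate {d : ℕ} (f : EuclideanSpace ℝ (Fin d) → ℝ)
    (xbar : EuclideanSpace ℝ (Fin d)) (μ ρ η σ Δ m : ℝ) (K k : ℕ)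
    (x : EuclideanSpace ℝ (Fin d)) : Prop where
  gap_le : gap f x ≤ Δ * (1 / 2) ^ k
  near : ‖x - xbar‖ + remainingTravel μ ρ Δ k < m
  superlinear : ∀ j, k = K + j → gap f x ≤ σ * (1 / 2) ^ ((1 + η) ^ j)

/-- The invariant of the transition system. In the fallback of outer iteration `k`, the number of
evaluations made in this fallback is the witness `i`. -/
def Invariant {d : ℕ} (f : EuclideanSpace ℝ (Fin d) → ℝ) (xbar : EuclideanSpace ℝ (Fin d))
    (μ ρ η σ Δ m ε : ℝ) (K NA N : ℕ) (c : Config (EuclideanSpace ℝ (Fin d))) : Prop :=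
  match c.state with
  | .top k x => IsOuterIterate f xbar μ ρ η σ Δ m K k x ∧ 0 < gap f x ∧ k < max 1 (K + N) ∧
      c.aEvals ≤ NA * min k K ∧ c.gEvals = d * k
  | .fallback k x z => IsOuterIterate f xbar μ ρ η σ Δ m K k x ∧ 0 < gap f x ∧
      k < max 1 (K + N) ∧ k < K ∧ c.gEvals = d * (k + 1) ∧ 0 < gap f z ∧
      ‖z - xbar‖ + (1 + ρ) / (1 - ρ) * Metric.infDist z (argminSet f) +
        remainingTravel μ ρ Δ (k + 1) < m ∧
      ∃ i < NA, c.aEvals ≤ NA * k + i ∧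
        Metric.infDist z (argminSet f) ≤ ρ ^ i * Metric.infDist x (argminSet f)
  | .halt x => gap f x ≤ ε ∧ c.aEvals ≤ NA * K ∧ c.gEvals ≤ d * max 1 (K + N)

theorem norm_le_of_polyakBundle {d : ℕ} {f : EuclideanSpace ℝ (Fin d) → ℝ}
    {g : EuclideanSpace ℝ (Fin d) → Set (EuclideanSpace ℝ (Fin d))}
    {x xt : EuclideanSpace ℝ (Fin d)} {τ : ℝ} (h : PolyakBundle f g x τ (some xt)) :
    ‖xt - x‖ ≤ τ * gap f x := by
  cases h with
  | point y v hrun s hs hmin =>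
    have := hs.2
    rwa [hrun.1] at this

namespace IsCoupledRegime

variable {d : ℕ} {f : EuclideanSpace ℝ (Fin d) → ℝ}
  {g : EuclideanSpace ℝ (Fin d) → Set (EuclideanSpace ℝ (Fin d))}
  {xbar : EuclideanSpace ℝ (Fin d)} {φ₁ φ₂ : ℝ}
  {A : Metric.ball xbar φ₁ → EuclideanSpace ℝ (Fin d)} {μ L ρ η Cs σ Δ m ε : ℝ} {K NA N : ℕ}

theorem contraction (h : IsCoupledRegime f g xbar φ₁ φ₂ A μ L ρ η Cs σ Δ m ε K NA N)
    {z : EuclideanSpace ℝ (Fin d)} (hz : z ∈ Metric.ball xbar φ₁) (hpos : 0 < gap f z)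
    (hlt : Metric.infDist z (argminSet f) < φ₂) :
    Metric.infDist (A ⟨z, hz⟩) (argminSet f) ≤ ρ * Metric.infDist z (argminSet f) ∧
      ‖A ⟨z, hz⟩ - z‖ ≤ (1 + ρ) * Metric.infDist z (argminSet f) := by
  obtain ⟨p, hp, hpz⟩ := exists_mem_projSet h.cont h.nonempty z
  have h1 := h.algorithm ⟨z, hz⟩ ((gap_pos_iff h.nonempty z).1 hpos) hlt p hp
  refine ⟨(infDist_argminSet_le hp.1 _).trans h1, ?_⟩
  have h2 : ‖A ⟨z, hz⟩ - z‖ ≤ ‖A ⟨z, hz⟩ - p‖ + ‖p - z‖ := norm_sub_le_norm_sub_add_norm_sub _ _ _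
  rw [hpz] at h2
  simp only at h1
  linarith

theorem ratio_nonneg (h : IsCoupledRegime f g xbar φ₁ φ₂ A μ L ρ η Cs σ Δ m ε K NA N) :
    0 ≤ (1 + ρ) / (1 - ρ) :=
  div_nonneg (by linarith [h.rate_pos]) (by linarith [h.rate_lt])

theorem remainingTravel_nonneg (h : IsCoupledRegime f g xbar φ₁ φ₂ A μ L ρ η Cs σ Δ m ε K NA N)
    (k : ℕ) : 0 ≤ remainingTravel μ ρ Δ k := by
  have h1 := h.ratio_nonneg
  have h2 := h.initialGap_nonneg
  have h3 := h.slope_pos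
  unfold remainingTravel
  positivity

theorem remainingTravel_eq (k : ℕ) :
    remainingTravel μ ρ Δ k = remainingTravel μ ρ Δ (k + 1) + Δ * (3 / 4) ^ k +
      (1 + ρ) / (1 - ρ) * (Δ / μ * (1 / 2) ^ k) := by
  rw [remainingTravel, remainingTravel, pow_succ, pow_succ]
  ring

theorem norm_lt (h : IsCoupledRegime f g xbar φ₁ φ₂ A μ L ρ η Cs σ Δ m ε K NA N) {k : ℕ}
    {x : EuclideanSpace ℝ (Fin d)} (hx : IsOuterIterate f xbar μ ρ η σ Δ m K k x) :
    ‖x - xbar‖ < m := by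
  linarith [hx.near, h.remainingTravel_nonneg k]

theorem infDist_le (h : IsCoupledRegime f g xbar φ₁ φ₂ A μ L ρ η Cs σ Δ m ε K NA N) {k : ℕ}
    {x : EuclideanSpace ℝ (Fin d)} (hx : IsOuterIterate f xbar μ ρ η σ Δ m K k x) :
    Metric.infDist x (argminSet f) ≤ Δ / μ * (1 / 2) ^ k := by
  have h1 := (h.growth x (h.norm_lt hx)).trans hx.gap_le
  rw [div_mul_eq_mul_div, le_div_iff₀ h.slope_pos]
  linarith

/-- A fallback or an accepted bundle call leads to the next outer iterate. -/
theorem isOuterIterate_succ (h : IsCoupledRegime f g xbar φ₁ φ₂ A μ L ρ η Cs σ Δ m ε K NA N)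
    {k : ℕ} {x x' : EuclideanSpace ℝ (Fin d)} (hx : IsOuterIterate f xbar μ ρ η σ Δ m K k x)
    (hhalf : gap f x' ≤ 1 / 2 * gap f x)
    (hnear : ‖x' - xbar‖ + remainingTravel μ ρ Δ (k + 1) < m)
    (hsuper : K ≤ k → gap f x' ≤ Cs * gap f x ^ (1 + η)) :
    IsOuterIterate f xbar μ ρ η σ Δ m K (k + 1) x' := by
  have hgap : gap f x' ≤ Δ * (1 / 2) ^ (k + 1) := by
    have := hx.gap_le
    rw [pow_succ]
    linarith
  refine ⟨hgap, hnear, fun j hj => ?_⟩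
  cases j with
  | zero =>
    rw [hj, Nat.add_zero] at hgap
    rw [pow_zero, Real.rpow_one]
    exact hgap.trans h.burnIn_le
  | succ j =>
    have hk : k = K + j := by omega
    have hη := h.order_pos
    have hσ := h.scale_pos
    have hCs := h.const_pos
    have h0 := SuperPolyak.gap_nonneg h.nonempty x
    set w : ℝ := (1 / 2 : ℝ) ^ ((1 + η) ^ j) with hw
    have hw0 : 0 < w := by positivity
    have h1 : gap f x ^ (1 + η) ≤ (σ * w) ^ (1 + η) :=
      Real.rpow_le_rpow h0 (hx.superlinear j hk) (by linarith)
    have h2 : (σ * w) ^ (1 + η) = σ ^ η * σ * (1 / 2 : ℝ) ^ ((1 + η) ^ (j + 1)) := by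
      rw [Real.mul_rpow hσ.le hw0.le, add_comm 1 η, Real.rpow_add hσ, Real.rpow_one, add_comm η 1,
        hw, ← Real.rpow_mul (by norm_num), ← pow_succ]
    have h3 : 0 < (1 / 2 : ℝ) ^ ((1 + η) ^ (j + 1)) := by positivity
    calc gap f x' ≤ Cs * gap f x ^ (1 + η) := hsuper (by omega)
      _ ≤ Cs * (σ ^ η * σ * (1 / 2 : ℝ) ^ ((1 + η) ^ (j + 1))) := by
          rw [← h2]; exact mul_le_mul_of_nonneg_left h1 hCs.le
      _ = Cs * σ ^ η * (σ * (1 / 2 : ℝ) ^ ((1 + η) ^ (j + 1))) := by ring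
      _ ≤ 1 * (σ * (1 / 2 : ℝ) ^ ((1 + η) ^ (j + 1))) := by
          have := h.scale_le
          gcongr
          linarith
      _ = _ := one_mul _

theorem isOuterIterate_of_polyakBundle
    (h : IsCoupledRegime f g xbar φ₁ φ₂ A μ L ρ η Cs σ Δ m ε K NA N)
    {k : ℕ} {x xt : EuclideanSpace ℝ (Fin d)} (hx : IsOuterIterate f xbar μ ρ η σ Δ m K k x)
    (hb : PolyakBundle f g x ((3 / 2 : ℝ) ^ k) (some xt)) (hlt : gap f xt < 1 / 2 * gap f x) :
    IsOuterIterate f xbar μ ρ η σ Δ m K (k + 1) xt := by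
  refine h.isOuterIterate_succ hx hlt.le ?_ fun hk => ?_
  · have h1 := norm_le_of_polyakBundle hb
    have h2 : (3 / 2 : ℝ) ^ k * gap f x ≤ (3 / 2 : ℝ) ^ k * (Δ * (1 / 2) ^ k) :=
      mul_le_mul_of_nonneg_left hx.gap_le (by positivity)
    have h3 : (3 / 2 : ℝ) ^ k * (Δ * (1 / 2) ^ k) = Δ * (3 / 4) ^ k := by
      rw [mul_left_comm, ← mul_pow]; norm_num
    have h4 : ‖xt - xbar‖ ≤ ‖xt - x‖ + ‖x - xbar‖ := norm_sub_le_norm_sub_add_norm_sub _ _ _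
    have h5 := hx.near
    rw [remainingTravel_eq] at h5
    have h6 : 0 ≤ (1 + ρ) / (1 - ρ) * (Δ / μ * (1 / 2) ^ k) :=
      mul_nonneg h.ratio_nonneg
        (mul_nonneg (div_nonneg h.initialGap_nonneg h.slope_pos.le) (by positivity))
    linarith
  · obtain ⟨x', hx', hg⟩ := h.bundle k hk x (h.norm_lt hx) hx.gap_le _ hb
    rwa [Option.some.inj hx']

/-- From outer iteration `K` on, the superlinear improvement is better than halving. -/
theorem gap_lt_half (h : IsCoupledRegime f g xbar φ₁ φ₂ A μ L ρ η Cs σ Δ m ε K NA N)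
    {k : ℕ} (hk : K ≤ k) {x xt : EuclideanSpace ℝ (Fin d)}
    (hx : IsOuterIterate f xbar μ ρ η σ Δ m K k x) (hpos : 0 < gap f x)
    (hxt : gap f xt ≤ Cs * gap f x ^ (1 + η)) : gap f xt < 1 / 2 * gap f x := by
  have hσ := h.scale_pos
  have h1 : gap f x < σ := by
    have e1 := hx.gap_le
    have e2 : (1 / 2 : ℝ) ^ k ≤ (1 / 2) ^ K :=
      pow_le_pow_of_le_one (by norm_num) (by norm_num) hk
    have e3 := mul_le_mul_of_nonneg_left e2 h.initialGap_nonneg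
    linarith [h.burnIn_le]
  have h2 : Cs * gap f x ^ η < 1 / 2 :=
    lt_of_lt_of_le (mul_lt_mul_of_pos_left (Real.rpow_lt_rpow hpos.le h1 h.order_pos) h.const_pos)
      h.scale_le
  calc gap f xt ≤ Cs * gap f x ^ (1 + η) := hxt
    _ = Cs * gap f x ^ η * gap f x := by
        rw [add_comm, Real.rpow_add hpos, Real.rpow_one, mul_assoc]
    _ < 1 / 2 * gap f x := mul_lt_mul_of_pos_right h2 hpos

theorem invariant_afterIterate (h : IsCoupledRegime f g xbar φ₁ φ₂ A μ L ρ η Cs σ Δ m ε K NA N)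
    {k a : ℕ} {x' : EuclideanSpace ℝ (Fin d)} (hk : k < max 1 (K + N)) (hε : 0 < ε)
    (hx' : IsOuterIterate f xbar μ ρ η σ Δ m K (k + 1) x') (ha : a ≤ NA * min (k + 1) K) :
    Invariant f xbar μ ρ η σ Δ m ε K NA N ⟨afterIterate f ε k x', a, d * (k + 1)⟩ := by
  by_cases hle : gap f x' ≤ ε
  · simp only [afterIterate, hle, if_true, Invariant]
    exact ⟨trivial, ha.trans (Nat.mul_le_mul_left _ (min_le_right _ _)),
      Nat.mul_le_mul_left _ hk⟩
  · simp only [afterIterate, hle, if_false, Invariant]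
    push Not at hle
    refine ⟨hx', hε.trans hle, ?_, ha, trivial⟩
    -- At iteration `K + N` the gap is at most `ε`, so the algorithm would have returned.
    by_contra! hge
    have h1 : k + 1 = max 1 (K + N) := by omega
    rcases le_or_gt (K + N) 1 with h2 | h2
    · have h3 : k + 1 = 1 := by rw [h1, max_eq_left h2]
      rcases Nat.eq_zero_or_pos (K + N) with h4 | h4
      · -- If `K + N = 0`, already the initial gap is at most `ε`.
        have hK : K = 0 := by omega
        have hN : N = 0 := by omega
        have e1 := h.burnIn_le
        have e2 := h.tail_le
        rw [hN, pow_zero, Real.rpow_one] at e2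
        have e3 := hx'.gap_le
        rw [h3, pow_one] at e3
        rw [hK, pow_zero] at e1
        linarith [h.initialGap_nonneg]
      · have := (hx'.superlinear N (by omega)).trans h.tail_le
        linarith
    · have := (hx'.superlinear N (by rw [h1, max_eq_right h2.le])).trans h.tail_le
      linarith

theorem infDist_fallback_lt (h : IsCoupledRegime f g xbar φ₁ φ₂ A μ L ρ η Cs σ Δ m ε K NA N)
    {k i : ℕ} {x z : EuclideanSpace ℝ (Fin d)} (hx : IsOuterIterate f xbar μ ρ η σ Δ m K k x)
    (hz : Metric.infDist z (argminSet f) ≤ ρ ^ i * Metric.infDist x (argminSet f)) :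
    Metric.infDist z (argminSet f) < φ₂ := by
  have h1 : ρ ^ i ≤ 1 := pow_le_one₀ h.rate_pos.le h.rate_lt.le
  have h2 := mul_le_of_le_one_left (Metric.infDist_nonneg (x := x) (s := argminSet f)) h1
  have h3 : Δ / μ * (1 / 2 : ℝ) ^ k ≤ Δ / μ :=
    mul_le_of_le_one_right (div_nonneg h.initialGap_nonneg h.slope_pos.le)
      (pow_le_one₀ (by norm_num) (by norm_num))
  linarith [h.infDist_le hx, h.initialGap_small]

theorem norm_fallback_lt (h : IsCoupledRegime f g xbar φ₁ φ₂ A μ L ρ η Cs σ Δ m ε K NA N)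
    {k : ℕ} {z : EuclideanSpace ℝ (Fin d)}
    (hz : ‖z - xbar‖ + (1 + ρ) / (1 - ρ) * Metric.infDist z (argminSet f) +
      remainingTravel μ ρ Δ (k + 1) < m) : ‖z - xbar‖ < m := by
  have h1 := mul_nonneg h.ratio_nonneg (Metric.infDist_nonneg (x := z) (s := argminSet f))
  linarith [h.remainingTravel_nonneg (k + 1)]

/-- One evaluation of the algorithmic mapping preserves the room left for the remaining steps: it
trades distance to the minimizers for travelled length. -/
theorem near_algorithm (h : IsCoupledRegime f g xbar φ₁ φ₂ A μ L ρ η Cs σ Δ m ε K NA N)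
    {k : ℕ} {z z' : EuclideanSpace ℝ (Fin d)}
    (hz : ‖z - xbar‖ + (1 + ρ) / (1 - ρ) * Metric.infDist z (argminSet f) +
      remainingTravel μ ρ Δ (k + 1) < m)
    (hdist : Metric.infDist z' (argminSet f) ≤ ρ * Metric.infDist z (argminSet f))
    (hmove : ‖z' - z‖ ≤ (1 + ρ) * Metric.infDist z (argminSet f)) :
    ‖z' - xbar‖ + (1 + ρ) / (1 - ρ) * Metric.infDist z' (argminSet f) +
      remainingTravel μ ρ Δ (k + 1) < m := by
  have h1 := mul_le_mul_of_nonneg_left hdist h.ratio_nonneg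
  have h2 : ‖z' - xbar‖ ≤ ‖z' - z‖ + ‖z - xbar‖ := norm_sub_le_norm_sub_add_norm_sub _ _ _
  have h3 : (1 + ρ) / (1 - ρ) * (ρ * Metric.infDist z (argminSet f)) +
      (1 + ρ) * Metric.infDist z (argminSet f) =
      (1 + ρ) / (1 - ρ) * Metric.infDist z (argminSet f) := by
    have : 1 - ρ ≠ 0 := by linarith [h.rate_lt]
    field_simp
    ring
  linarith

/-- After `NA` evaluations in one fallback the function gap has been halved. -/
theorem gap_le_half_of_fallback
    (h : IsCoupledRegime f g xbar φ₁ φ₂ A μ L ρ η Cs σ Δ m ε K NA N)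
    {k i : ℕ} {x z : EuclideanSpace ℝ (Fin d)} (hx : IsOuterIterate f xbar μ ρ η σ Δ m K k x)
    (hz : ‖z - xbar‖ < m) (hi : NA ≤ i)
    (hdist : Metric.infDist z (argminSet f) ≤ ρ ^ i * Metric.infDist x (argminSet f)) :
    gap f z ≤ 1 / 2 * gap f x := by
  have hμ := h.slope_pos
  have hL : 0 ≤ L := hμ.le.trans h.slope_le
  have h0 := SuperPolyak.gap_nonneg h.nonempty x
  have h1 : Metric.infDist x (argminSet f) ≤ gap f x / μ := by
    rw [le_div_iff₀ hμ]; linarith [h.growth x (h.norm_lt hx)]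
  have h2 : ρ ^ i ≤ ρ ^ NA := pow_le_pow_of_le_one h.rate_pos.le h.rate_lt.le hi
  have hρ := h.rate_pos
  calc gap f z ≤ L * Metric.infDist z (argminSet f) := h.lipschitz z hz
    _ ≤ L * (ρ ^ i * Metric.infDist x (argminSet f)) := by gcongr
    _ ≤ L * (ρ ^ NA * (gap f x / μ)) := by
        gcongr
        exact Metric.infDist_nonneg
    _ = L / μ * ρ ^ NA * gap f x := by ring
    _ ≤ 1 / 2 * gap f x := mul_le_mul_of_nonneg_right h.fallback_le h0

theorem invariant_step (h : IsCoupledRegime f g xbar φ₁ φ₂ A μ L ρ η Cs σ Δ m ε K NA N)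
    (hε : 0 < ε) {c c' : Config (EuclideanSpace ℝ (Fin d))}
    (hc : Invariant f xbar μ ρ η σ Δ m ε K NA N c) (hstep : Step f g xbar φ₁ A ε c c') :
    Invariant f xbar μ ρ η σ Δ m ε K NA N c' := by
  cases hstep with
  | accept k a n x xt hb hlt =>
    obtain ⟨hx, hpos, hk, ha, hn⟩ := hc
    simp only at ha hn
    rw [hn, ← Nat.mul_succ]
    exact h.invariant_afterIterate hk hε (h.isOuterIterate_of_polyakBundle hx hb hlt)
      (ha.trans (Nat.mul_le_mul_left _ (min_le_min_right _ (Nat.le_succ k))))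
  | reject k a n x r hb hnot =>
    obtain ⟨hx, hpos, hk, ha, hn⟩ := hc
    simp only at ha hn
    have hkK : k < K := by
      by_contra! hge
      obtain ⟨xt, hr, hxt⟩ := h.bundle k hge x (h.norm_lt hx) hx.gap_le r hb
      exact hnot xt hr (h.gap_lt_half hge hx hpos hxt)
    refine ⟨hx, hpos, hk, hkK, by simp only [hn, Nat.mul_succ], hpos, ?_, 0, h.fallback_pos, ?_, ?_⟩
    · have h1 := hx.near
      rw [remainingTravel_eq] at h1
      have h2 := mul_le_mul_of_nonneg_left (h.infDist_le hx) h.ratio_nonneg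
      have h3 : 0 ≤ Δ * (3 / 4 : ℝ) ^ k := mul_nonneg h.initialGap_nonneg (by positivity)
      linarith
    · exact ha.trans (Nat.mul_le_mul_left _ (min_le_left _ _))
    · simp
  | fallbackContinue k a n x z hz hgt =>
    obtain ⟨hx, hpos, hk, hkK, hn, hzpos, hnear, i, hi, ha, hd⟩ := hc
    obtain ⟨hc1, hc2⟩ := h.contraction hz hzpos (h.infDist_fallback_lt hx hd)
    have hnear' := h.near_algorithm hnear hc1 hc2
    have hd' : Metric.infDist (A ⟨z, hz⟩) (argminSet f) ≤
        ρ ^ (i + 1) * Metric.infDist x (argminSet f) := by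
      rw [pow_succ', mul_assoc]
      exact hc1.trans (mul_le_mul_of_nonneg_left hd h.rate_pos.le)
    push Not at hgt
    refine ⟨hx, hpos, hk, hkK, hn, by linarith, hnear', i + 1, ?_, ?_, hd'⟩
    · by_contra! hge
      have := h.gap_le_half_of_fallback hx (h.norm_fallback_lt hnear') hge hd'
      linarith
    · simp only at ha ⊢
      omega
  | fallbackReturn k a n x z hz hle =>
    obtain ⟨hx, hpos, hk, hkK, hn, hzpos, hnear, i, hi, ha, hd⟩ := hc
    obtain ⟨hc1, hc2⟩ := h.contraction hz hzpos (h.infDist_fallback_lt hx hd)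
    have hnear' := h.near_algorithm hnear hc1 hc2
    simp only at ha hn
    rw [hn]
    refine h.invariant_afterIterate hk hε (h.isOuterIterate_succ hx hle ?_ fun hge => ?_) ?_
    · have := mul_nonneg h.ratio_nonneg
        (Metric.infDist_nonneg (x := A ⟨z, hz⟩) (s := argminSet f))
      linarith
    · omega
    · rw [min_eq_left (by omega), Nat.mul_succ]
      omega

theorem invariant_of_reachable
    (h : IsCoupledRegime f g xbar φ₁ φ₂ A μ L ρ η Cs σ Δ m ε K NA N)
    (hε : 0 < ε) {x₀ : EuclideanSpace ℝ (Fin d)} (hx₀ : IsOuterIterate f xbar μ ρ η σ Δ m K 0 x₀)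
    (hpos : 0 < gap f x₀) {c : Config (EuclideanSpace ℝ (Fin d))}
    (hc : Reachable f g xbar φ₁ A ε x₀ c) : Invariant f xbar μ ρ η σ Δ m ε K NA N c := by
  induction hc with
  | refl => exact ⟨hx₀, hpos, by omega, by simp, by simp⟩
  | tail _ hstep ih => exact h.invariant_step hε ih hstep

theorem exists_step (h : IsCoupledRegime f g xbar φ₁ φ₂ A μ L ρ η Cs σ Δ m ε K NA N)
    {c : Config (EuclideanSpace ℝ (Fin d))} (hc : Invariant f xbar μ ρ η σ Δ m ε K NA N c)
    (hnot : ¬ c.Halted) : ∃ c', Step f g xbar φ₁ A ε c c' := by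
  obtain ⟨s, a, n⟩ := c
  cases s with
  | top k x =>
    obtain ⟨r, hr⟩ := exists_polyakBundle f h.grad_nonempty x ((3 / 2 : ℝ) ^ k)
    by_cases hacc : ∃ xt, r = some xt ∧ gap f xt < 1 / 2 * gap f x
    · obtain ⟨xt, rfl, hlt⟩ := hacc
      exact ⟨_, .accept k a n x xt hr hlt⟩
    · exact ⟨_, .reject k a n x r hr fun xt hxt hlt => hacc ⟨xt, hxt, hlt⟩⟩
  | fallback k x z =>
    obtain ⟨-, -, -, -, -, -, hnear, -⟩ := hc
    have hz : z ∈ Metric.ball xbar φ₁ :=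
      mem_ball_iff_norm.2 ((h.norm_fallback_lt hnear).trans_le h.radius_le)
    by_cases hle : gap f (A ⟨z, hz⟩) ≤ 1 / 2 * gap f x
    · exact ⟨_, .fallbackReturn k a n x z hz hle⟩
    · exact ⟨_, .fallbackContinue k a n x z hz hle⟩
  | halt x => exact absurd ⟨x, rfl⟩ hnot

theorem evals_le {c : Config (EuclideanSpace ℝ (Fin d))}
    (hc : Invariant f xbar μ ρ η σ Δ m ε K NA N c) :
    c.aEvals + c.gEvals ≤ NA * K + d * max 1 (K + N) := by
  obtain ⟨s, a, n⟩ := c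
  cases s with
  | top k x =>
    obtain ⟨-, -, hk, ha, hn⟩ := hc
    exact add_le_add (ha.trans (Nat.mul_le_mul_left _ (min_le_right _ _)))
      (hn.le.trans (Nat.mul_le_mul_left _ hk.le))
  | fallback k x z =>
    obtain ⟨-, -, hk, hkK, hn, -, -, i, hi, ha, -⟩ := hc
    refine add_le_add (ha.trans ?_) (hn.le.trans (Nat.mul_le_mul_left _ hk))
    calc NA * k + i ≤ NA * (k + 1) := by rw [Nat.mul_succ]; omega
      _ ≤ NA * K := Nat.mul_le_mul_left _ hkK
  | halt x => exact add_le_add hc.2.1 hc.2.2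

theorem evals_lt_of_step (hd : 0 < d) {c c' : Config (EuclideanSpace ℝ (Fin d))}
    (hstep : Step f g xbar φ₁ A ε c c') : c.aEvals + c.gEvals < c'.aEvals + c'.gEvals := by
  cases hstep <;> simp only <;> omega

/-- Every step costs an evaluation and the number of evaluations is bounded by the invariant, so
every run halts. -/
theorem terminatesWithin (h : IsCoupledRegime f g xbar φ₁ φ₂ A μ L ρ η Cs σ Δ m ε K NA N)
    (hε : 0 < ε) {x₀ : EuclideanSpace ℝ (Fin d)} (hx₀ : IsOuterIterate f xbar μ ρ η σ Δ m K 0 x₀)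
    (hpos : 0 < gap f x₀) :
    TerminatesWithin f g xbar φ₁ A ε x₀ (NA * K) (d * max 1 (K + N)) := by
  refine ⟨fun c hc hnot => h.exists_step (h.invariant_of_reachable hε hx₀ hpos hc) hnot,
    fun c hc => ?_⟩
  have hreach : ∀ n, Reachable f g xbar φ₁ A ε x₀ (c n) := by
    intro n
    induction n with
    | zero => rw [hc.1]; exact .refl
    | succ n ih =>
      rcases hc.2 n with hs | ⟨-, hs⟩
      · exact ih.tail hs
      · rw [hs]; exact ih
  have hinv := fun n => h.invariant_of_reachable hε hx₀ hpos (hreach n)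
  obtain ⟨n, x, hn⟩ : ∃ n, (c n).Halted := by
    by_contra! hnone
    have hcount : ∀ n, n ≤ (c n).aEvals + (c n).gEvals := by
      intro n
      induction n with
      | zero => exact Nat.zero_le _
      | succ n ih =>
        rcases hc.2 n with hs | ⟨hh, -⟩
        · exact Nat.succ_le_of_lt (ih.trans_lt (evals_lt_of_step h.dim_pos hs))
        · exact absurd hh (hnone n)
    have h1 := (hcount (NA * K + d * max 1 (K + N) + 1)).trans (evals_le (hinv _))
    omega
  have hfin := hinv n
  simp only [Invariant, hn] at hfin
  exact ⟨n, x, hn, hfin⟩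

theorem superlinearFrom (h : IsCoupledRegime f g xbar φ₁ φ₂ A μ L ρ η Cs σ Δ m ε K NA N)
    (hε : 0 < ε) {x₀ : EuclideanSpace ℝ (Fin d)} (hx₀ : IsOuterIterate f xbar μ ρ η σ Δ m K 0 x₀)
    (hpos : 0 < gap f x₀) : SuperlinearFrom f g xbar φ₁ A ε x₀ η Cs K := by
  intro k a n x c' hk hreach hstep
  obtain ⟨hx, hxpos, -⟩ := h.invariant_of_reachable hε hx₀ hpos hreach
  cases hstep with
  | accept _ _ _ _ xt hb hlt =>
    obtain ⟨x', hx', hg⟩ := h.bundle k hk x (h.norm_lt hx) hx.gap_le _ hb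
    obtain rfl := Option.some.inj hx'
    exact ⟨xt, rfl, hg⟩
  | reject _ _ _ _ r hb hnot =>
    obtain ⟨xt, hr, hxt⟩ := h.bundle k hk x (h.norm_lt hx) hx.gap_le r hb
    exact absurd (h.gap_lt_half hk hx hxpos hxt) (hnot xt hr)

end IsCoupledRegime

/-! ### The numbers of iterations -/

theorem le_pow_of_logb_le {b X t : ℝ} {K : ℕ} (hb : 1 < b) (hX : 0 < X) (ht : X ≤ t)
    (hK : Real.logb b t ≤ K) : X ≤ b ^ K := by
  have h1 := (Real.logb_le_iff_le_rpow hb (hX.trans_le ht)).1 hK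
  rw [Real.rpow_natCast] at h1
  exact ht.trans h1

/-- What the three logarithms and the threshold in the definition of `burnIn` provide. -/
theorem burnIn_spec {μ Cb η L Cs Δ : ℝ} (hμ : 0 < μ) (hL : 0 < L) (hCs : 0 < Cs)
    (hΔ : 0 < Δ) :
    Δ * (2 * (2 * Cs) ^ (1 / η)) ≤ 2 ^ burnIn μ Cb η L Cs Δ ∧
      Δ * (L / μ * Cs) ^ (1 / η) ≤ 2 ^ burnIn μ Cb η L Cs Δ ∧
      3 / μ ≤ (3 / 2 : ℝ) ^ burnIn μ Cb η L Cs Δ := by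
  have h := Nat.le_ceil (max
    (Real.logb 2 (Δ * max (2 * (2 * Cs) ^ (1 / η))
      (max ((2 * Cb) ^ (1 / η) / μ ^ (1 + 1 / η)) ((L / μ * Cs) ^ (1 / η)))))
    (Real.logb (3 / 2) (3 / μ)))
  have h1 := (le_max_left _ _).trans h
  have h2 := (le_max_right _ _).trans h
  refine ⟨le_pow_of_logb_le (by norm_num) (by positivity) ?_ h1,
    le_pow_of_logb_le (by norm_num) (by positivity) ?_ h1,
    le_pow_of_logb_le (by norm_num) (by positivity) le_rfl h2⟩
  · exact mul_le_mul_of_nonneg_left (le_max_left _ _) hΔ.le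
  · exact mul_le_mul_of_nonneg_left ((le_max_right _ _).trans (le_max_right _ _)) hΔ.le

/-- The tail bound; replacing `ε` by `min ε (1 / 2)` makes the inner logarithm at least `1`. -/
theorem half_pow_le_of_ceil_le {η ε : ℝ} (hη : 0 < η) (hε : 0 < ε) :
    (1 / 2 : ℝ) ^ ((1 + η) ^
      ⌈Real.log (Real.logb 2 (1 / min ε (1 / 2))) / Real.log (1 + η)⌉₊) ≤ ε := by
  set N := ⌈Real.log (Real.logb 2 (1 / min ε (1 / 2))) / Real.log (1 + η)⌉₊ with hN
  set e := min ε (1 / 2) with he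
  have he0 : 0 < e := lt_min hε (by norm_num)
  have hlog : 0 < Real.log (1 + η) := Real.log_pos (by linarith)
  have hl : 1 ≤ Real.logb 2 (1 / e) := by
    rw [Real.le_logb_iff_rpow_le (by norm_num) (by positivity), Real.rpow_one,
      le_div_iff₀ he0]
    linarith [min_le_right ε (1 / 2)]
  have h1 : Real.logb 2 (1 / e) ≤ (1 + η) ^ N := by
    have := Nat.le_ceil (Real.log (Real.logb 2 (1 / e)) / Real.log (1 + η))
    rw [← hN, div_le_iff₀ hlog] at this
    rwa [← Real.log_le_log_iff (by linarith) (by positivity), Real.log_pow]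
  rw [Real.logb_le_iff_le_rpow (by norm_num) (by positivity)] at h1
  rw [one_div, Real.inv_rpow (by norm_num)]
  calc ((2 : ℝ) ^ ((1 + η) ^ N))⁻¹ ≤ (1 / e)⁻¹ := inv_anti₀ (by positivity) h1
    _ = e := by simp
    _ ≤ ε := min_le_left _ _

/-- Enough fallback iterations to gain the factor `2 κ`, by `ρ ≤ exp (-(1 - ρ))`. -/
theorem fallback_budget {κ ρ : ℝ} (hκ : 1 ≤ κ) (hρ : 0 < ρ) (hρ1 : ρ < 1) :
    0 < ⌈1 / (1 - ρ) * Real.log (2 * κ)⌉₊ ∧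
      κ * ρ ^ ⌈1 / (1 - ρ) * Real.log (2 * κ)⌉₊ ≤ 1 / 2 := by
  have h1 : 0 < 1 - ρ := by linarith
  have h2 : 0 < Real.log (2 * κ) := Real.log_pos (by linarith)
  refine ⟨Nat.ceil_pos.2 (by positivity), ?_⟩
  set n := ⌈1 / (1 - ρ) * Real.log (2 * κ)⌉₊ with hn
  have h3 : Real.log (2 * κ) ≤ n * (1 - ρ) := by
    have := Nat.le_ceil (1 / (1 - ρ) * Real.log (2 * κ))
    rwa [← hn, div_mul_eq_mul_div, one_mul, div_le_iff₀ h1] at this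
  have h4 : ρ ^ n ≤ (2 * κ)⁻¹ := by
    calc ρ ^ n ≤ Real.exp (-(1 - ρ)) ^ n := by
          gcongr
          linarith [Real.add_one_le_exp (-(1 - ρ))]
      _ = Real.exp (-(n * (1 - ρ))) := by rw [← Real.exp_nat_mul]; ring_nf
      _ ≤ Real.exp (-Real.log (2 * κ)) := Real.exp_le_exp.2 (by linarith)
      _ = (2 * κ)⁻¹ := by rw [Real.exp_neg, Real.exp_log (by linarith)]
  calc κ * ρ ^ n ≤ κ * (2 * κ)⁻¹ := by gcongr
    _ = 1 / 2 := by field_simp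

/-! ### The radii -/

/-- The condition on `‖x₀ - xbar‖` leaves room for all steps of the algorithm. The bound on the
total travel is a sum where the radius has a maximum; the spare factor `2 / (1 - ρ)` makes up for
it. -/
theorem norm_add_remainingTravel_lt {μ L ρ Δ D r m : ℝ} (hμ : 0 < μ) (hL : 0 < L) (hρ : 0 < ρ)
    (hρ1 : ρ < 1) (hΔ : Δ ≤ L * D) (hD : D ≤ r) (hr : 0 < r)
    (hrm : r ≤ (2 / (1 - ρ) * (1 + max (2 * (L / μ) * ((1 + ρ) / (1 - ρ))) (4 * L)))⁻¹ * m) :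
    r + remainingTravel μ ρ Δ 0 < m := by
  have h1 : 0 < 1 - ρ := by linarith
  have hB : 0 < (1 + ρ) / (1 - ρ) := div_pos (by linarith) h1
  set R := max (2 * (L / μ) * ((1 + ρ) / (1 - ρ))) (4 * L) with hR
  have hR1 : 2 * (L / μ) * ((1 + ρ) / (1 - ρ)) ≤ R := le_max_left _ _
  have hR2 : 4 * L ≤ R := le_max_right _ _
  have hΔr : Δ ≤ L * r := hΔ.trans (mul_le_mul_of_nonneg_left hD hL.le)
  have h2 : 2 / (1 - ρ) * (1 + R) * r ≤ m := by
    have hpos : 0 < 2 / (1 - ρ) * (1 + R) := by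
      have : 0 < R := by linarith
      positivity
    calc 2 / (1 - ρ) * (1 + R) * r
        ≤ 2 / (1 - ρ) * (1 + R) * ((2 / (1 - ρ) * (1 + R))⁻¹ * m) :=
          mul_le_mul_of_nonneg_left hrm hpos.le
      _ = m := mul_inv_cancel_left₀ hpos.ne' m
  have h3 : 2 < 2 / (1 - ρ) := by rw [lt_div_iff₀ h1]; linarith
  have h4 : 2 * ((1 + R) * r) < 2 / (1 - ρ) * ((1 + R) * r) :=
    mul_lt_mul_of_pos_right h3 (mul_pos (by linarith) hr)
  have h5 : remainingTravel μ ρ Δ 0 ≤ 2 * R * r := by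
    have e1 : 4 * Δ ≤ R * r := by
      calc 4 * Δ ≤ 4 * L * r := by linarith
        _ ≤ R * r := mul_le_mul_of_nonneg_right hR2 hr.le
    have e2 : 2 * ((1 + ρ) / (1 - ρ) * (Δ / μ)) ≤ R * r := by
      calc 2 * ((1 + ρ) / (1 - ρ) * (Δ / μ)) ≤ 2 * ((1 + ρ) / (1 - ρ) * (L * r / μ)) := by gcongr
        _ = 2 * (L / μ) * ((1 + ρ) / (1 - ρ)) * r := by ring
        _ ≤ R * r := mul_le_mul_of_nonneg_right hR1 hr.le
    rw [remainingTravel, pow_zero, pow_zero]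
    linarith
  linarith

theorem gap_div_lt {μ L ρ Δ D φ : ℝ} (hμ : 0 < μ) (hL : 0 < L) (hρ : 0 < ρ) (hρ1 : ρ < 1)
    (hΔ : Δ ≤ L * D) (hφ : 0 < φ)
    (hD : D ≤ φ / (1 + max (2 * (L / μ) * ((1 + ρ) / (1 - ρ))) (4 * L / 3))) : Δ / μ < φ := by
  have h1 : 0 < 1 - ρ := by linarith
  have hκ : 0 < L / μ := div_pos hL hμ
  set R := max (2 * (L / μ) * ((1 + ρ) / (1 - ρ))) (4 * L / 3) with hR
  have h2 : 1 ≤ (1 + ρ) / (1 - ρ) := by rw [le_div_iff₀ h1]; linarith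
  have h3 : L / μ < 1 + R := by
    have e1 : 2 * (L / μ) * ((1 + ρ) / (1 - ρ)) ≤ R := le_max_left _ _
    have e2 : 2 * (L / μ) * 1 ≤ 2 * (L / μ) * ((1 + ρ) / (1 - ρ)) :=
      mul_le_mul_of_nonneg_left h2 (by linarith)
    linarith
  have h4 : 0 < 1 + R := hκ.trans h3
  calc Δ / μ ≤ L * D / μ := by gcongr
    _ = L / μ * D := by ring
    _ ≤ L / μ * (φ / (1 + R)) := mul_le_mul_of_nonneg_left hD hκ.le
    _ < (1 + R) * (φ / (1 + R)) := mul_lt_mul_of_pos_right h3 (by positivity)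
    _ = φ := by field_simp

/-- The radius of the superlinear regime, expressed by the function gap. -/
theorem div_le_improvement_radius {μ L Cs η Δ : ℝ} {K k : ℕ} (hμ : 0 < μ) (hL : 0 < L)
    (hCs : 0 < Cs) (hη : 0 < η) (hΔ : 0 ≤ Δ) (hK : Δ * (L / μ * Cs) ^ (1 / η) ≤ 2 ^ K)
    (hk : K ≤ k) :
    Δ * (1 / 2) ^ k / μ ≤ (μ ^ (1 - η) / (L * Cs)) ^ (1 / η) := by
  have h1 : (μ ^ (1 - η) / (L * Cs)) ^ (1 / η) = μ⁻¹ * ((L / μ * Cs) ^ (1 / η))⁻¹ := by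
    have e1 : μ ^ (1 - η) / (L * Cs) = μ ^ (-η) * (L / μ * Cs)⁻¹ := by
      rw [sub_eq_add_neg, Real.rpow_add hμ, Real.rpow_one]
      field_simp
    rw [e1, Real.mul_rpow (by positivity) (by positivity), ← Real.rpow_mul hμ.le,
      Real.inv_rpow (by positivity), neg_mul, mul_one_div_cancel hη.ne', Real.rpow_neg_one]
  have h2 : Δ * (1 / 2 : ℝ) ^ k ≤ ((L / μ * Cs) ^ (1 / η))⁻¹ := by
    have hX : 0 < (L / μ * Cs) ^ (1 / η) := by positivity
    rw [← one_div, le_div_iff₀ hX]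
    calc Δ * (1 / 2 : ℝ) ^ k * (L / μ * Cs) ^ (1 / η)
        ≤ Δ * (1 / 2 : ℝ) ^ K * (L / μ * Cs) ^ (1 / η) := by
          gcongr Δ * ?_ * _
          exact pow_le_pow_of_le_one (by norm_num) (by norm_num) hk
      _ = Δ * (L / μ * Cs) ^ (1 / η) * (1 / 2 : ℝ) ^ K := by ring
      _ ≤ 2 ^ K * (1 / 2 : ℝ) ^ K := by gcongr
      _ = 1 := by rw [← mul_pow]; norm_num
  rw [h1, div_eq_inv_mul]
  exact mul_le_mul_of_nonneg_left h2 (inv_nonneg.2 hμ.le)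

end SuperPolyak

end

theorem mainTheorem2 (d : ℕ) (hd : 0 < d) (μ Cb η L : ℝ) (hμ : 0 < μ) (hCb : 0 < Cb)
    (hη : 0 < η) :
    ∃ Cs : ℝ, 0 < Cs ∧
      ∀ (f : EuclideanSpace ℝ (Fin d) → ℝ)
        (g : EuclideanSpace ℝ (Fin d) → Set (EuclideanSpace ℝ (Fin d)))
        (xbar : EuclideanSpace ℝ (Fin d)) (δ : ℝ),
        LocallyLipschitz f → SuperPolyak.IsGeneralizedGradientMap g →
        xbar ∈ SuperPolyak.argminSet f → 0 < δ →
        SuperPolyak.Sharp f xbar δ μ → SuperPolyak.BRegular f g xbar δ Cb η →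
        SuperPolyak.IsLipBound f g xbar δ L →
        SuperPolyak.SuperlinearImprovement f g xbar δ μ Cb η L Cs ∧
        ∀ (φ₁ φ₂ ρ : ℝ) (A : Metric.ball xbar φ₁ → EuclideanSpace ℝ (Fin d))
          (x₀ : EuclideanSpace ℝ (Fin d)),
          0 < φ₂ → φ₂ ≤ φ₁ → 0 < ρ → ρ < 1 →
          SuperPolyak.IsAlgorithmicMapping f xbar φ₁ φ₂ ρ A →
          x₀ ∉ SuperPolyak.argminSet f →
          ‖x₀ - xbar‖ ≤
            (2 / (1 - ρ) * (1 + max (2 * (L / μ) * ((1 + ρ) / (1 - ρ))) (4 * L)))⁻¹ *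
              min (δ / 4) φ₁ →
          Metric.infDist x₀ (SuperPolyak.argminSet f) ≤
            φ₂ / (1 + max (2 * (L / μ) * ((1 + ρ) / (1 - ρ))) (4 * L / 3)) →
          ∀ ε : ℝ, 0 < ε →
            SuperPolyak.TerminatesWithin f g xbar φ₁ A ε x₀
              (⌈1 / (1 - ρ) * Real.log (2 * (L / μ))⌉₊ *
                SuperPolyak.burnIn μ Cb η L Cs (SuperPolyak.gap f x₀))
              (d * max 1 (SuperPolyak.burnIn μ Cb η L Cs (SuperPolyak.gap f x₀) +
                ⌈Real.log (Real.logb 2 (1 / min ε (1 / 2))) / Real.log (1 + η)⌉₊)) ∧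
            SuperPolyak.SuperlinearFrom f g xbar φ₁ A ε x₀ η Cs
              (SuperPolyak.burnIn μ Cb η L Cs (SuperPolyak.gap f x₀)) := by
  have hCs := SuperPolyak.improvementConst_pos d μ Cb η L
  refine ⟨SuperPolyak.improvementConst d μ Cb η L, hCs, ?_⟩
  intro f g xbar δ hlip hg hxbar hδ hsharp hreg hL
  have hf := hlip.continuous
  have hne : (SuperPolyak.argminSet f).Nonempty := ⟨_, hxbar⟩
  refine ⟨fun τ hτ x hx hD r hr => SuperPolyak.exists_eq_some_of_polyakBundle hd hμ hCb hη hf hxbar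
    hsharp hreg hL hτ.le hx (hD.trans (min_le_right _ _)) hr, ?_⟩
  intro φ₁ φ₂ ρ A x₀ hφ₂ hφ hρ hρ1 hA hx₀ hnear hdist ε hε
  set Cs := SuperPolyak.improvementConst d μ Cb η L with hCsdef
  set Δ := SuperPolyak.gap f x₀ with hΔdef
  set K := SuperPolyak.burnIn μ Cb η L Cs Δ with hKdef
  have hm : 0 < min (δ / 4) φ₁ := lt_min (by linarith) (hφ₂.trans_le hφ)
  have hΔ : 0 < Δ := (SuperPolyak.gap_pos_iff hne x₀).2 hx₀
  have hD₀ : 0 < Metric.infDist x₀ (SuperPolyak.argminSet f) :=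
    ((SuperPolyak.isClosed_argminSet hf).notMem_iff_infDist_pos hne).1 hx₀
  have hDr := SuperPolyak.infDist_argminSet_le hxbar x₀
  have hL0 : 0 ≤ L := by
    obtain ⟨v, hv⟩ := hg.1 xbar
    exact (norm_nonneg v).trans (hL.1 xbar (Metric.mem_ball_self hδ) v hv)
  have hx₀δ : ‖x₀ - xbar‖ < δ / 4 := by
    -- The factor in front of the minimum is at most `1 / 2`.
    have h1 : 0 < 1 - ρ := by linarith
    have h2 : 2 ≤ 2 / (1 - ρ) * (1 + max (2 * (L / μ) * ((1 + ρ) / (1 - ρ))) (4 * L)) := by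
      have e1 : 2 ≤ 2 / (1 - ρ) := by rw [le_div_iff₀ h1]; linarith
      have e2 : 4 * L ≤ max (2 * (L / μ) * ((1 + ρ) / (1 - ρ))) (4 * L) := le_max_right _ _
      calc (2 : ℝ) = 2 * 1 := by norm_num
        _ ≤ _ := mul_le_mul e1 (by linarith) zero_le_one (by linarith)
    have h3 := mul_le_mul_of_nonneg_right (inv_anti₀ two_pos h2) hm.le
    linarith [min_le_left (δ / 4) φ₁]
  have hLμ := SuperPolyak.slope_le_lipBound hf hxbar hsharp hL hx₀δ hD₀
  have hLpos : 0 < L := hμ.trans_le hLμ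
  have hgapD := SuperPolyak.gap_le_mul_infDist hf hxbar hL hx₀δ
  obtain ⟨hK1, hK2, hK3⟩ := SuperPolyak.burnIn_spec (Cb := Cb) (η := η) hμ hLpos hCs hΔ
  rw [← hKdef] at hK1 hK2 hK3
  obtain ⟨hNA0, hNA⟩ := SuperPolyak.fallback_budget (κ := L / μ) ((one_le_div hμ).2 hLμ) hρ hρ1
  have hball : ∀ z, ‖z - xbar‖ < min (δ / 4) φ₁ → z ∈ Metric.ball xbar δ := fun z hz =>
    mem_ball_iff_norm.2 (by linarith [min_le_left (δ / 4) φ₁])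
  have h2Cs : 1 ≤ 2 * Cs := by linarith [SuperPolyak.half_le_improvementConst d μ Cb η L]
  have hregime : SuperPolyak.IsCoupledRegime f g xbar φ₁ φ₂ A μ L ρ η Cs ((2 * Cs) ^ (1 / η))⁻¹ Δ
      (min (δ / 4) φ₁) ε K ⌈1 / (1 - ρ) * Real.log (2 * (L / μ))⌉₊
      ⌈Real.log (Real.logb 2 (1 / min ε (1 / 2))) / Real.log (1 + η)⌉₊ :=
    { dim_pos := hd
      cont := hf
      nonempty := hne
      grad_nonempty := hg.1
      slope_pos := hμ
      slope_le := hLμ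
      order_pos := hη
      const_pos := hCs
      scale_pos := by positivity
      scale_le := by
        rw [Real.inv_rpow (by positivity), ← Real.rpow_mul (by positivity),
          one_div_mul_cancel hη.ne', Real.rpow_one]
        exact le_of_eq (by field_simp)
      rate_pos := hρ
      rate_lt := hρ1
      radius_le := min_le_right _ _
      growth := fun z hz => hsharp z (hball z hz)
      lipschitz := fun z hz =>
        SuperPolyak.gap_le_mul_infDist hf hxbar hL (hz.trans_le (min_le_left _ _))
      algorithm := hA
      bundle := by
        intro k hk x hx hgx r hr
        refine SuperPolyak.exists_eq_some_of_polyakBundle hd hμ hCb hη hf hxbar hsharp hreg hL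
          (hK3.trans (pow_le_pow_right₀ (by norm_num) hk)) (hx.trans_le (min_le_left _ _)) ?_ hr
        refine le_trans ?_ (SuperPolyak.div_le_improvement_radius hμ hLpos hCs hη hΔ.le hK2 hk)
        rw [le_div_iff₀ hμ]
        linarith [hsharp x (hball x hx)]
      initialGap_small := SuperPolyak.gap_div_lt hμ hLpos hρ hρ1 hgapD hφ₂ hdist
      initialGap_nonneg := hΔ.le
      burnIn_le := by
        have hX : 0 < (2 * Cs) ^ (1 / η) := by positivity
        rw [one_div_pow, mul_one_div, div_le_iff₀ (by positivity), mul_assoc,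
          ← div_eq_inv_mul, le_div_iff₀ hX]
        linarith
      fallback_pos := hNA0
      fallback_le := hNA
      tail_le := by
        have h1 := SuperPolyak.half_pow_le_of_ceil_le hη hε
        have h2 : ((2 * Cs) ^ (1 / η))⁻¹ ≤ 1 :=
          inv_le_one_of_one_le₀ (Real.one_le_rpow h2Cs (by positivity))
        exact (mul_le_of_le_one_left (by positivity) h2).trans h1 }
  have hstart : SuperPolyak.IsOuterIterate f xbar μ ρ η ((2 * Cs) ^ (1 / η))⁻¹ Δ
      (min (δ / 4) φ₁) K 0 x₀ := by
    refine ⟨by simp [hΔdef], SuperPolyak.norm_add_remainingTravel_lt hμ hLpos hρ hρ1 hgapD hDr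
      (hD₀.trans_le hDr) hnear, fun j hj => ?_⟩
    have hK0 : K = 0 := by omega
    have hj0 : j = 0 := by omega
    have := hregime.burnIn_le
    rw [hK0, pow_zero, mul_one] at this
    rwa [hj0, pow_zero, Real.rpow_one]
  exact ⟨hregime.terminatesWithin hε hstart hΔ, hregime.superlinearFrom hε hstart hΔ⟩
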